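/- **Conventions.** Let $K\ge 1$ and let $m_1,\dots,m_K\ge 1$ be integers. For a $K$-array $Z\in\mathbb R^{m_1\times\cdots\times m_K}$ and a list $A=\{A_1,\dots,A_K\}$ of matrices $A_k\in\mathbb R^{m_k\times m_k}$, the Tucker product $Z\times A$ is the array with entries $(Z\times A)_{i_1\ldots i_K}=\sum_{j_1,\ldots,j_K}\bigl(\prod_k (A_k)_{i_kj_k}\bigr)Z_{j_1\ldots j_K}$; $Z_{(k)}$ denotes the $k$-mode matricization of an array (the matrix with $m_k$ rows whose columns run over the values of the remaining indices), and $\Sigma_1\circ\cdots\circ\Sigma_K$ is the outer product, with entries $\prod_k(\Sigma_k)_{i_kj_k}$. We write $\mathrm{anorm}(M,C)$ for the law of $M+Z\times A$, where $Z$ has i.i.d. standard normal entries, the $A_k$ are nonsingular and $C=(A_1A_1^T)\circ\cdots\circ(A_KA_K^T)$. For a positive definite $d\times d$ matrix $V$ and real $\nu>d-1$, $\text{inverse-Wishart}(V,\nu)$ is the law on positive definite $d\times d$ matrices $X$ with density, with respect to $\prod_{i\le j}dx_{ij}$, proportional to $|X|^{-(\nu+d+1)/2}\exp\{-\mathrm{tr}(V^{-1}X^{-1})/2\}$.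 Finally, $\mathrm{gamma}(a,b)$ has shape $a$ and rate $b$ (mean $a/b$). **Statement.** Let $\nu_{0k}>m_k-1$ be real for $k=1,\dots,K$. (1) Let $n\ge1$, $\kappa_0>0$, $M_0\in\mathbb R^{m_1\times\cdots\times m_K}$, and let $S_{0k}$ be positive definite $m_k\times m_k$ matrices. Suppose that $\Sigma_1,\dots,\Sigma_K$ are independent with $\Sigma_k\sim\text{inverse-Wishart}(S_{0k}^{-1},\nu_{0k})$, that $M\mid\Sigma\sim\mathrm{anorm}(M_0,\Sigma_1\circ\cdots\circ\Sigma_K/\kappa_0)$, and that, given $(M,\Sigma)$, the arrays $Y_1,\dots,Y_n$ are i.i.d. $\mathrm{anorm}(M,\Sigma_1\circ\cdots\circ\Sigma_K)$. Write $Y=(Y_1,\dots,Y_n)$, $\bar Y=\frac1n\sum_iY_i$ and $\Sigma_{-k}=(\Sigma_j)_{j\ne k}$. Then, almost surely, $$M\mid Y,\Sigma\ \sim\ \mathrm{anorm}\!\left(\frac{\kappa_0M_0+n\bar Y}{\kappa_0+n},\ \frac{\Sigma_1\circ\cdots\circ\Sigma_K}{\kappa_0+n}\right),$$ and for every $k$,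 $$\Sigma_k\mid Y,\Sigma_{-k}\ \sim\ \text{inverse-Wishart}\bigl([S_{0k}+S_k+R_{(k)}R_{(k)}^T]^{-1},\ \nu_{0k}+n_k\bigr).$$ Here $n_k=n\prod_{j\ne k}m_j$. For $j\neq k$ let $A_j$ be any matrix with $A_jA_j^T=\Sigma_j$, and put $B=\{A_1^{-1},\dots,A_{k-1}^{-1},I_{m_k},A_{k+1}^{-1},\dots,A_K^{-1}\}$. Then $S_k=\tilde E_{(k)}\tilde E_{(k)}^T$, where $\tilde E$ is the $m_1\times\cdots\times m_K\times n$ array obtained by stacking the arrays $(Y_i-\bar Y)\times B$, $i=1,\dots,n$, along an additional last mode, and $R=\sqrt{\kappa_0n/(\kappa_0+n)}\,(\bar Y-M_0)\times B$. The statement holds for every choice of the square roots $A_j$. (2) Let $a,b>0$ and let $\Sigma_{0k}$ be positive definite $m_k\times m_k$ matrices. Suppose that $\gamma\sim\mathrm{gamma}(a,b)$ and that, given $\gamma$, the matrices $\Sigma_1,\dots,\Sigma_K$ are independent with $\Sigma_k\sim\text{inverse-Wishart}(S_{0k}^{-1},\nu_{0k})$, where $S_{0k}=\gamma\Sigma_{0k}$.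 Then, almost surely, $$\gamma\mid\Sigma_1,\dots,\Sigma_K\ \sim\ \mathrm{gamma}\!\left(a+\sum_{k=1}^K\frac{\nu_{0k}m_k}{2},\ b+\sum_{k=1}^K\frac{\mathrm{tr}(\Sigma_k^{-1}\Sigma_{0k})}{2}\right).$$ -/

import Mathlib

open MeasureTheory ProbabilityTheory
open scoped BigOperators ENNReal

/-- Matrices carry the product sigma-algebra of their entries. -/
instance instMeasurableSpaceMatrixReal {p q : Type*} : MeasurableSpace (Matrix p q ℝ) :=
  inferInstanceAs (MeasurableSpace (p → q → ℝ))

instance instStandardBorelSpaceMatrixReal {p q : Type*} [Countable p] [Countable q] :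
    StandardBorelSpace (Matrix p q ℝ) :=
  inferInstanceAs (StandardBorelSpace (p → q → ℝ))

noncomputable section

namespace ArrayNormal

/-- Index set of an array with dimension vector `m = (m_1, …, m_K)`. -/
abbrev Idx {K : ℕ} (m : Fin K → ℕ) : Type := ∀ k : Fin K, Fin (m k)

/-- Real `m_1 × ⋯ × m_K` arrays. -/
abbrev Arr {K : ℕ} (m : Fin K → ℕ) : Type := Idx m → ℝ

/-- Lists `(A_1, …, A_K)` of real square matrices, `A_k` of size `m_k × m_k`. -/
abbrev MatList {K : ℕ} (m : Fin K → ℕ) : Type :=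
  ∀ k : Fin K, Matrix (Fin (m k)) (Fin (m k)) ℝ

/-- Lists `(A_j)_{j ≠ k}` of real square matrices, one for each mode other than `k`. -/
abbrev MatListExcept {K : ℕ} (m : Fin K → ℕ) (k : Fin K) : Type :=
  ∀ j : {j : Fin K // j ≠ k}, Matrix (Fin (m j)) (Fin (m j)) ℝ

variable {K : ℕ} {m : Fin K → ℕ}

/-- The Tucker product `Z × {A_1, …, A_K}` with square matrices. -/
def tucker (Z : Arr m) (A : MatList m) : Arr m :=
  fun i => ∑ j : Idx m, (∏ k, A k (i k) (j k)) * Z j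

/-- The outer product `Σ_1 ∘ ⋯ ∘ Σ_K`, whose entry at `(i, j)` is `∏ k, Σ_k (i_k, j_k)`. -/
def outer (S : MatList m) : Idx m → Idx m → ℝ :=
  fun i j => ∏ k, S k (i k) (j k)

/-- The `k`-mode matricization `Z_(k)`. The columns are indexed by the tuples of the remaining
indices. -/
def unfold (k : Fin K) (Z : Arr m) :
    Matrix (Fin (m k)) (∀ j : {j : Fin K // j ≠ k}, Fin (m j)) ℝ :=
  Matrix.of fun a c => Z ((Equiv.piSplitAt k (fun j => Fin (m j))).symm (a, c))

/-- The `k`-mode matricization of the `m_1 × ⋯ × m_K × n` array obtained by stacking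
`E_1, …, E_n` along an additional last mode. -/
def unfoldStack {n : ℕ} (k : Fin K) (E : Fin n → Arr m) :
    Matrix (Fin (m k)) ((∀ j : {j : Fin K // j ≠ k}, Fin (m j)) × Fin n) ℝ :=
  Matrix.of fun a c => unfold k (E c.2) a c.1

/-- The law of an array with independent standard normal entries. -/
def stdArrayNormal (m : Fin K → ℕ) : Measure (Arr m) :=
  Measure.pi fun _ => gaussianReal 0 1

/-- `IsArrayNormal μ M C`: the measure `μ` is the array normal law `anorm(M, C)`, that is, the law
of `M + Z × {A_1, …, A_K}`, where `Z` has independent standard normal entries, the `A_k` are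
nonsingular, and the covariance array `C` equals `(A_1 A_1ᵀ) ∘ ⋯ ∘ (A_K A_Kᵀ)`. -/
def IsArrayNormal (μ : Measure (Arr m)) (M : Arr m) (C : Idx m → Idx m → ℝ) : Prop :=
  ∃ A : MatList m, (∀ k, IsUnit (A k).det) ∧ C = outer (fun k => A k * (A k).transpose) ∧
    μ = (stdArrayNormal m).map (fun Z => M + tucker Z A)

/-- The symmetric matrix with given entries on and above the diagonal. -/
def symmOfUpper {d : ℕ} (t : {p : Fin d × Fin d // p.1 ≤ p.2} → ℝ) : Matrix (Fin d) (Fin d) ℝ :=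
  Matrix.of fun i j => t ⟨(min i j, max i j), min_le_max⟩

open Classical in
/-- The unnormalised inverse-Wishart density with scale matrix `V` and `ν` degrees of freedom,
`|X| ^ (-(ν + d + 1) / 2) * exp (-tr (V⁻¹ X⁻¹) / 2)` on positive definite `X`, zero elsewhere. -/
def invWishartKernel {d : ℕ} (V : Matrix (Fin d) (Fin d) ℝ) (ν : ℝ)
    (X : Matrix (Fin d) (Fin d) ℝ) : ℝ≥0∞ :=
  if X.PosDef then
    ENNReal.ofReal (X.det ^ (-(ν + d + 1) / 2) * Real.exp (-(V⁻¹ * X⁻¹).trace / 2))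
  else 0

/-- The measure on symmetric matrices with density `invWishartKernel V ν` with respect to Lebesgue
measure `∏_{i ≤ j} dx_{ij}`. -/
def invWishartUnnorm {d : ℕ} (V : Matrix (Fin d) (Fin d) ℝ) (ν : ℝ) :
    Measure (Matrix (Fin d) (Fin d) ℝ) :=
  ((volume : Measure ({p : Fin d × Fin d // p.1 ≤ p.2} → ℝ)).withDensity
    (fun t => invWishartKernel V ν (symmOfUpper t))).map symmOfUpper

/-- The inverse-Wishart law `inverse-Wishart(V, ν)`: the law of `X` when `X⁻¹ ~ Wishart(V, ν)`,
given by its density normalised to total mass one (for `V` positive definite and `ν > d - 1`). -/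
def invWishart {d : ℕ} (V : Matrix (Fin d) (Fin d) ℝ) (ν : ℝ) :
    Measure (Matrix (Fin d) (Fin d) ℝ) :=
  (invWishartUnnorm V ν Set.univ)⁻¹ • invWishartUnnorm V ν

/-- The sample mean of the arrays `Y_1, …, Y_n`. -/
def sampleMean {n : ℕ} (Y : Fin n → Arr m) : Arr m :=
  (n : ℝ)⁻¹ • ∑ i, Y i

/-- The list `{A_1⁻¹, …, A_{k-1}⁻¹, I, A_{k+1}⁻¹, …, A_K⁻¹}`. -/
def invExcept (k : Fin K) (A : MatListExcept m k) : MatList m :=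
  fun j => if h : j = k then 1 else (A ⟨j, h⟩)⁻¹

/-- `S_k = Ẽ_(k) Ẽ_(k)ᵀ`, where `Ẽ` stacks the residual arrays `Y_i - Ȳ`, standardized along every
mode except `k` by the inverses of the square roots `A_j`. -/
def residualSS {n : ℕ} (k : Fin K) (A : MatListExcept m k) (Y : Fin n → Arr m) :
    Matrix (Fin (m k)) (Fin (m k)) ℝ :=
  let E := unfoldStack k (fun i => tucker (Y i - sampleMean Y) (invExcept k A))
  E * E.transpose

/-- `R = √(κ₀ n / (κ₀ + n)) (Ȳ - M₀) × {A_1⁻¹, …, A_{k-1}⁻¹, I, A_{k+1}⁻¹, …, A_K⁻¹}`. -/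
def meanDeviation {n : ℕ} (k : Fin K) (A : MatListExcept m k) (Y : Fin n → Arr m)
    (M₀ : Arr m) (κ₀ : ℝ) : Arr m :=
  Real.sqrt (κ₀ * n / (κ₀ + n)) • tucker (sampleMean Y - M₀) (invExcept k A)

/-- The effective sample size `n_k = n ∏_{j ≠ k} m_j` of mode `k`. -/
def modeSampleSize (m : Fin K → ℕ) (n : ℕ) (k : Fin K) : ℕ :=
  n * ∏ j ∈ Finset.univ.erase k, m j

/-- The array normal model with semiconjugate prior, for random variables on `(Ω, P)`:
the `Σ_k` are independent with `Σ_k ~ inverse-Wishart(S₀ₖ⁻¹, ν₀ₖ)`;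
given `Σ`, `M ~ anorm(M₀, Σ_1 ∘ ⋯ ∘ Σ_K / κ₀)`;
given `M` and `Σ`, the `Y_i` are i.i.d. `anorm(M, Σ_1 ∘ ⋯ ∘ Σ_K)`. -/
structure SemiconjugateModel {Ω : Type*} [MeasurableSpace Ω] (P : Measure Ω)
    [IsProbabilityMeasure P] {n : ℕ} (M₀ : Arr m) (κ₀ : ℝ) (S₀ : MatList m) (ν₀ : Fin K → ℝ)
    (Sig : Ω → MatList m) (M : Ω → Arr m) (Y : Ω → Fin n → Arr m) : Prop where
  measurable_Sig : Measurable Sig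
  measurable_M : Measurable M
  measurable_Y : Measurable Y
  indep_Sig : iIndepFun (fun k ω => Sig ω k) P
  law_Sig : ∀ k, P.map (fun ω => Sig ω k) = invWishart (S₀ k)⁻¹ (ν₀ k)
  cond_M : ∀ᵐ σ ∂(P.map Sig), IsArrayNormal (condDistrib M Sig P σ) M₀ (κ₀⁻¹ • outer σ)
  cond_Y : ∀ᵐ p ∂(P.map (fun ω => (M ω, Sig ω))), ∃ ρ : Measure (Arr m),
    IsArrayNormal ρ p.1 (outer p.2) ∧
      condDistrib Y (fun ω => (M ω, Sig ω)) P p = Measure.pi (fun _ => ρ)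

/-- The hierarchical prior with random scale, for random variables on `(Ω, P)`:
`γ ~ gamma(a, b)` with shape `a` and rate `b`, and given `γ` the `Σ_k` are independent with
`Σ_k ~ inverse-Wishart((γ Σ₀ₖ)⁻¹, ν₀ₖ)`. -/
structure RandomScalePrior {Ω : Type*} [MeasurableSpace Ω] (P : Measure Ω)
    [IsProbabilityMeasure P] (a b : ℝ) (Sig₀ : MatList m) (ν₀ : Fin K → ℝ)
    (γ : Ω → ℝ) (Sig : Ω → MatList m) : Prop where
  measurable_γ : Measurable γ
  measurable_Sig : Measurable Sig
  law_γ : P.map γ = gammaMeasure a b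
  cond_Sig : ∀ᵐ g ∂(P.map γ),
    condDistrib Sig γ P g = Measure.pi (fun k => invWishart (g • Sig₀ k)⁻¹ (ν₀ k))

end ArrayNormal

end

noncomputable section

namespace ArrayNormal

variable {K : ℕ} {m : Fin K → ℕ}

/-! ### Densities of product measures and of push-forwards -/

section MeasureTheory

/-! Everything is Bayes' rule for densities: if `(X, Y)` has a joint density against a product
measure, the conditional law of `Y` given `X = x` is the renormalised section of that density at
`x`. A section therefore only has to be identified up to a factor free of the second variable, since
total mass one determines that factor (`condDistrib_ae_eq_normalize`). For this reason the
normalising integral of the inverse-Wishart law is never evaluated, nor shown to be finite.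

Mean array: an array normal law is a multivariate normal law whose covariance matrix is a multiple
of the Kronecker product of the `Σ_k`. Completing the square in `M`
(`normalDensity_mul_prod_normalDensity`) factors prior times likelihood into a normal density in `M`
and a marginal density of the data, whose exponent involves only the residuals `Y_i - Ȳ` and the
deviation `Ȳ - M₀`.

Covariance matrices: integrating `M` out leaves this marginal density. With the other matrices
fixed, the determinant of the Kronecker product is a constant times the power `∏_{j ≠ k} m_j` of
`|Σ_k|`, and its inverse quadratic form is `tr(Σ_k⁻¹ Z_(k) Z_(k)ᵀ)`, where `Z` is the array
standardised in the other modes (`precisionForm_outerMatrix`). In `Σ_k` the likelihood is thus a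
power of the determinant times the exponential of a trace against `Σ_k⁻¹`; multiplying it by the
prior kernel adds exponents and scale matrices (`invWishartKernel_mul_marginalDensity`).

Random scale: the substitution `X = γ X'` shows that the normalising integral for `(γ S)⁻¹` is `γ ^
(-ν d / 2)` times the one for `S⁻¹`. The trace in the kernel is linear in `γ`, so as a function of
`γ` the density of the `Σ_k` has the shape of a gamma density, and multiplying by the gamma prior
adds shapes and rates. -/

theorem lintegral_fin_prod_eq_prod {n : ℕ} {E : Fin n → Type*} {mE : ∀ i, MeasurableSpace (E i)}
    {μ : ∀ i, Measure (E i)} [∀ i, SigmaFinite (μ i)] {f : ∀ i, E i → ℝ≥0∞}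
    (hf : ∀ i, Measurable (f i)) :
    ∫⁻ x : (∀ i, E i), ∏ i, f i (x i) ∂(Measure.pi μ) = ∏ i, ∫⁻ x, f i x ∂(μ i) := by
  induction n with
  | zero => simp
  | succ n ih =>
    have hm : Measurable fun x : ∀ i : Fin n, E i.succ => ∏ i : Fin n, f i.succ (x i) :=
      Finset.measurable_prod _ fun i _ => (hf _).comp (measurable_pi_apply i)
    have h1 := (measurePreserving_piFinSuccAbove μ 0).lintegral_comp
      (f := fun x => f 0 x.1 * ∏ i : Fin n, f i.succ (x.2 i))
      (((hf 0).comp measurable_fst).mul (hm.comp measurable_snd))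
    rw [Fin.prod_univ_succ, ← ih (fun i => hf _), ← lintegral_prod_mul (hf 0).aemeasurable
      hm.aemeasurable]
    refine Eq.trans ?_ h1
    simp_rw [Fin.prod_univ_succ]
    rfl

theorem lintegral_fintype_prod_eq_prod {ι : Type*} [Fintype ι] {E : ι → Type*}
    {mE : ∀ i, MeasurableSpace (E i)} {μ : ∀ i, Measure (E i)} [∀ i, SigmaFinite (μ i)]
    {f : ∀ i, E i → ℝ≥0∞} (hf : ∀ i, Measurable (f i)) :
    ∫⁻ x : (∀ i, E i), ∏ i, f i (x i) ∂(Measure.pi μ) = ∏ i, ∫⁻ x, f i x ∂(μ i) := by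
  let e := (Fintype.equivFin ι).symm
  have hm : Measurable fun x : ∀ i, E i => ∏ i, f i (x i) :=
    Finset.measurable_prod _ fun i _ => (hf _).comp (measurable_pi_apply i)
  rw [← (measurePreserving_piCongrLeft μ e).lintegral_comp hm]
  simp_rw [← e.prod_comp, MeasurableEquiv.coe_piCongrLeft, Equiv.piCongrLeft_apply_apply]
  exact lintegral_fin_prod_eq_prod fun i => hf _

theorem pi_withDensity {ι : Type*} [Fintype ι] {E : ι → Type*}
    {mE : ∀ i, MeasurableSpace (E i)} (μ : ∀ i, Measure (E i)) [∀ i, SigmaFinite (μ i)]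
    {f : ∀ i, E i → ℝ≥0∞} (hf : ∀ i, Measurable (f i))
    [∀ i, SigmaFinite ((μ i).withDensity (f i))] :
    Measure.pi (fun i => (μ i).withDensity (f i)) =
      (Measure.pi μ).withDensity fun x => ∏ i, f i (x i) := by
  refine Measure.pi_eq fun s hs => ?_
  rw [withDensity_apply _ (MeasurableSet.univ_pi hs), Measure.restrict_pi_pi,
    lintegral_fintype_prod_eq_prod hf]
  exact Finset.prod_congr rfl fun i _ => (withDensity_apply _ (hs i)).symm

/-- No injectivity of `e` is needed, because the density is already a function of `e x`. All changes
of variables below pass through this form. -/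
theorem map_withDensity_of_measurePreserving {α β : Type*} [MeasurableSpace α]
    [MeasurableSpace β] {μ : Measure α} {ν : Measure β} {e : α → β} (he : MeasurePreserving e μ ν)
    {f : β → ℝ≥0∞} (hf : Measurable f) :
    (μ.withDensity fun x => f (e x)).map e = ν.withDensity f := by
  ext s hs
  rw [Measure.map_apply he.measurable hs, withDensity_apply _ (he.measurable hs),
    withDensity_apply _ hs, he.setLIntegral_comp_preimage hs hf]

theorem _root_.Measurable.prodMk_section {α β γ : Type*} [MeasurableSpace α] [MeasurableSpace β]
    [MeasurableSpace γ] {f : α × β → γ} (hf : Measurable f) (x : α) :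
    Measurable fun y => f (x, y) :=
  hf.comp measurable_prodMk_left

/-! ### Bayes' rule for joint densities -/

section Bayes

variable {Ω α β : Type*} [MeasurableSpace Ω] [MeasurableSpace α] [MeasurableSpace β]
  {P : Measure Ω} {X : Ω → α} {Y : Ω → β} {μ : Measure α} {ν : Measure β}
  [SFinite ν]

theorem map_fst_eq_withDensity [SFinite μ] {f : α × β → ℝ≥0∞} (hX : Measurable X)
    (hY : Measurable Y) (hf : Measurable f)
    (hj : P.map (fun ω => (X ω, Y ω)) = (μ.prod ν).withDensity f) :
    P.map X = μ.withDensity fun x => ∫⁻ y, f (x, y) ∂ν := by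
  have : P.map X = (P.map (fun ω => (X ω, Y ω))).map Prod.fst := by
    rw [Measure.map_map measurable_fst (hX.prodMk hY)]; rfl
  rw [this, hj]
  ext s hs
  rw [Measure.map_apply measurable_fst hs, withDensity_apply _ (measurable_fst hs),
    withDensity_apply _ hs, ← Set.prod_univ, setLIntegral_prod _ hf.aemeasurable]
  simp

theorem map_prodMk_swap_eq_withDensity [SFinite μ] {f : α × β → ℝ≥0∞} (hX : Measurable X)
    (hY : Measurable Y) (hf : Measurable f)
    (hj : P.map (fun ω => (X ω, Y ω)) = (μ.prod ν).withDensity f) :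
    P.map (fun ω => (Y ω, X ω)) = (ν.prod μ).withDensity fun p => f p.swap := by
  have hf' : Measurable fun p : β × α => f p.swap := hf.comp measurable_swap
  rw [← map_withDensity_of_measurePreserving (Measure.measurePreserving_swap (μ := μ) (ν := ν)) hf']
  simp only [Prod.swap_swap]
  rw [← hj, Measure.map_map measurable_swap (hX.prodMk hY)]
  rfl

variable [IsProbabilityMeasure P] [StandardBorelSpace β] [Nonempty β]

/-- The chain rule, marginal density times conditional density; it assembles joint laws from the
hierarchical description of the models. -/
theorem map_prodMk_eq_withDensity {f : α → ℝ≥0∞} {g : α × β → ℝ≥0∞} (hY : Measurable Y)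
    (hf : Measurable f) (hg : Measurable g) (hfX : P.map X = μ.withDensity f)
    (hc : ∀ᵐ x ∂(P.map X), condDistrib Y X P x = ν.withDensity fun y => g (x, y)) :
    P.map (fun ω => (X ω, Y ω)) = (μ.prod ν).withDensity fun p => f p.1 * g p := by
  have hfg : Measurable fun p : α × β => f p.1 * g p := (hf.comp measurable_fst).mul hg
  rw [← compProd_map_condDistrib hY.aemeasurable]
  refine Measure.ext_of_lintegral _ fun F hF => ?_
  rw [Measure.lintegral_compProd hF, lintegral_withDensity_eq_lintegral_mul _ hfg hF,
    lintegral_prod _ (hfg.mul hF).aemeasurable]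
  have h1 : ∫⁻ x, ∫⁻ y, F (x, y) ∂(condDistrib Y X P x) ∂(P.map X) =
      ∫⁻ x, ∫⁻ y, g (x, y) * F (x, y) ∂ν ∂(P.map X) := by
    refine lintegral_congr_ae ?_
    filter_upwards [hc] with x hx
    rw [hx, lintegral_withDensity_eq_lintegral_mul _ (hg.prodMk_section x) (hF.prodMk_section x)]
    rfl
  have hgF : Measurable fun x => ∫⁻ y, g (x, y) * F (x, y) ∂ν := (hg.mul hF).lintegral_prod_right'
  rw [h1, hfX, lintegral_withDensity_eq_lintegral_mul _ hf hgF]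
  refine lintegral_congr fun x => ?_
  simp only [Pi.mul_apply, mul_assoc]
  exact (lintegral_const_mul (f x) ((hg.mul hF).prodMk_section x)).symm

theorem condDistrib_ae_eq_smul_withDensity [SFinite μ] {f : α × β → ℝ≥0∞} (hX : Measurable X)
    (hY : Measurable Y) (hf : Measurable f)
    (hj : P.map (fun ω => (X ω, Y ω)) = (μ.prod ν).withDensity f) :
    ∀ᵐ x ∂(P.map X), condDistrib Y X P x =
      (∫⁻ y, f (x, y) ∂ν)⁻¹ • ν.withDensity fun y => f (x, y) := by
  set c : α → ℝ≥0∞ := fun x => ∫⁻ y, f (x, y) ∂ν with hc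
  have hcm : Measurable c := hf.lintegral_prod_right'
  have hmX : P.map X = μ.withDensity c := map_fst_eq_withDensity hX hY hf hj
  set κ : Kernel α β := Kernel.withDensity (Kernel.const α ν) fun x y => (c x)⁻¹ * f (x, y)
    with hκ
  have hgm : Measurable (Function.uncurry fun x y => (c x)⁻¹ * f (x, y)) :=
    (hcm.inv.comp measurable_fst).mul hf
  have hκx : ∀ x, κ x = (c x)⁻¹ • ν.withDensity fun y => f (x, y) := fun x => by
    rw [hκ, Kernel.withDensity_apply _ hgm, Kernel.const_apply,
      ← withDensity_smul _ (hf.prodMk_section x)]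
    rfl
  -- The bound `c⁻¹ * c ≤ 1` also covers `c = 0` and `c = ∞`, so `κ` is finite at every point, not
  -- just almost everywhere.
  have : IsFiniteKernel κ := ⟨1, ENNReal.one_lt_top, fun x => by
    rw [hκx, Measure.smul_apply, withDensity_apply _ MeasurableSet.univ, Measure.restrict_univ,
      smul_eq_mul]
    exact ENNReal.inv_mul_le_one _⟩
  suffices h : condDistrib Y X P =ᵐ[P.map X] κ by
    filter_upwards [h] with x hx
    rw [hx, hκx]
  refine condDistrib_ae_eq_of_measure_eq_compProd X hY.aemeasurable ?_
  rw [hj]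
  have hfin : ∀ᵐ x ∂μ, c x ≠ ∞ := by
    have : ∫⁻ x, c x ∂μ ≠ ∞ := by
      have h2 : μ.withDensity c Set.univ = ∫⁻ x, c x ∂μ := by simp
      rw [← h2, ← hmX]
      exact measure_ne_top _ _
    filter_upwards [ae_lt_top hcm this] with x hx using hx.ne
  refine Measure.ext_of_lintegral _ fun F hF => ?_
  rw [Measure.lintegral_compProd hF, lintegral_withDensity_eq_lintegral_mul _ hf hF,
    lintegral_prod _ (hf.mul hF).aemeasurable, hmX,
    lintegral_withDensity_eq_lintegral_mul _ hcm hF.lintegral_kernel_prod_right']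
  refine lintegral_congr_ae ?_
  filter_upwards [hfin] with x hx
  simp only [Pi.mul_apply]
  rw [hκx, lintegral_smul_measure, lintegral_withDensity_eq_lintegral_mul _
    (hf.prodMk_section x) (hF.prodMk_section x), smul_eq_mul, ← mul_assoc]
  -- If `c x = 0`, the section vanishes almost everywhere and both sides are zero, whatever the
  -- value of `(c x)⁻¹`.
  rcases eq_or_ne (c x) 0 with h0 | h0
  · have h3 : ∀ᵐ y ∂ν, f (x, y) = 0 :=
      (lintegral_eq_zero_iff (hf.prodMk_section x)).1 h0
    have h4 : ∫⁻ y, f (x, y) * F (x, y) ∂ν = 0 := by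
      rw [lintegral_congr_ae (g := fun _ => 0)]
      · simp
      · filter_upwards [h3] with y hy
        rw [hy, zero_mul]
    rw [h4, h0]
    simp
  · rw [ENNReal.mul_inv_cancel h0 hx, one_mul]
    rfl

/-- A conditional law has mass one, which forces the constant in front of `U` to be the inverse of
the mass of `U`; degenerate values of `d` or of that mass are excluded automatically. The null set
is chosen before `U` and `d`, so uncountably many candidates may be tested at the same `x`. -/
theorem condDistrib_ae_eq_normalize [SFinite μ] {f : α × β → ℝ≥0∞} (hX : Measurable X)
    (hY : Measurable Y) (hf : Measurable f)
    (hj : P.map (fun ω => (X ω, Y ω)) = (μ.prod ν).withDensity f) :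
    ∀ᵐ x ∂(P.map X), ∀ (U : Measure β) (d : ℝ≥0∞), (ν.withDensity fun y => f (x, y)) = d • U →
      condDistrib Y X P x = (U Set.univ)⁻¹ • U := by
  filter_upwards [condDistrib_ae_eq_smul_withDensity hX hY hf hj] with x hx U d hU
  rw [hU, smul_smul] at hx
  have h1 : condDistrib Y X P x Set.univ = 1 := measure_univ
  rw [hx, Measure.smul_apply, smul_eq_mul] at h1
  rw [hx, ← ENNReal.eq_inv_of_mul_eq_one_left h1]

theorem condDistrib_ae_eq_of_isProbabilityMeasure [SFinite μ] {f : α × β → ℝ≥0∞} (hX : Measurable X)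
    (hY : Measurable Y) (hf : Measurable f)
    (hj : P.map (fun ω => (X ω, Y ω)) = (μ.prod ν).withDensity f) :
    ∀ᵐ x ∂(P.map X), ∀ (ρ : Measure β) (d : ℝ≥0∞), IsProbabilityMeasure ρ →
      (ν.withDensity fun y => f (x, y)) = d • ρ → condDistrib Y X P x = ρ := by
  filter_upwards [condDistrib_ae_eq_normalize hX hY hf hj] with x hx ρ d hρ h
  rw [hx ρ d h, measure_univ, inv_one, one_smul]

end Bayes

end MeasureTheory

/-! ### The multivariate normal density -/

section Gaussian

open Matrix

variable {ι : Type*} [Fintype ι]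

theorem pi_gaussianReal_eq_withDensity :
    (Measure.pi fun _ : ι => gaussianReal 0 1) = (volume : Measure (ι → ℝ)).withDensity fun z =>
      ENNReal.ofReal ((√((2 * Real.pi) ^ Fintype.card ι))⁻¹ * Real.exp (-(z ⬝ᵥ z) / 2)) := by
  have h : gaussianReal 0 1 = volume.withDensity (gaussianPDF 0 1) :=
    gaussianReal_of_var_ne_zero 0 one_ne_zero
  have : SigmaFinite ((volume : Measure ℝ).withDensity (gaussianPDF 0 1)) := by
    rw [← h]; infer_instance
  rw [h, pi_withDensity _ fun _ => measurable_gaussianPDF 0 1, ← volume_pi]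
  congr 1
  ext z
  simp only [gaussianPDF, gaussianPDFReal]
  rw [← ENNReal.ofReal_prod_of_nonneg fun i _ => by positivity, Finset.prod_mul_distrib,
    ← Real.exp_sum]
  congr 2
  · simp [Real.sqrt_eq_rpow, ← Real.rpow_natCast, ← Real.rpow_mul, Real.pi_pos.le, mul_comm]
  · simp [dotProduct, ← Finset.sum_div, ← Finset.sum_neg_distrib, sq]

variable [DecidableEq ι]

/-- The quadratic form `z ↦ zᵀ C⁻¹ z`. -/
def precisionForm (C : Matrix ι ι ℝ) (z : ι → ℝ) : ℝ := z ⬝ᵥ (C⁻¹ *ᵥ z)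

/-- The density of the multivariate normal law with mean `M` and covariance matrix `C`. -/
def normalDensity (C : Matrix ι ι ℝ) (M y : ι → ℝ) : ℝ≥0∞ :=
  ENNReal.ofReal ((√((2 * Real.pi) ^ Fintype.card ι * C.det))⁻¹ *
    Real.exp (-precisionForm C (y - M) / 2))

theorem precisionForm_mul_transpose {A : Matrix ι ι ℝ} (hA : IsUnit A.det) (z : ι → ℝ) :
    precisionForm (A * Aᵀ) (A *ᵥ z) = z ⬝ᵥ z := by
  have hT : IsUnit Aᵀ.det := by rwa [det_transpose]
  rw [precisionForm, Matrix.mul_inv_rev, ← mulVec_mulVec, mulVec_mulVec z, nonsing_inv_mul _ hA,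
    one_mulVec, dotProduct_mulVec, vecMul_mulVec, mul_nonsing_inv _ hT, vecMul_one]

theorem map_add_mulVec_pi_gaussianReal {A : Matrix ι ι ℝ} (hA : IsUnit A.det) (M : ι → ℝ) :
    (Measure.pi fun _ : ι => gaussianReal 0 1).map (fun Z => M + A *ᵥ Z) =
      (volume : Measure (ι → ℝ)).withDensity (normalDensity (A * Aᵀ) M) := by
  have h0 : A.det ≠ 0 := hA.ne_zero
  have hmeas : Measurable (normalDensity (A * Aᵀ) M) := by
    unfold normalDensity precisionForm
    refine ENNReal.measurable_ofReal.comp (Continuous.measurable ?_)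
    fun_prop
  have hmap : MeasurePreserving (fun Z => M + A *ᵥ Z) (volume : Measure (ι → ℝ))
      (ENNReal.ofReal |(A.det)⁻¹| • volume) := by
    have h1 : MeasurePreserving (fun Z => A *ᵥ Z) (volume : Measure (ι → ℝ))
        (ENNReal.ofReal |(A.det)⁻¹| • volume) :=
      ⟨by fun_prop, Real.map_matrix_volume_pi_eq_smul_volume_pi h0⟩
    exact ((measurePreserving_add_left (volume : Measure (ι → ℝ)) M).smul_measure _).comp h1
  -- The image of Lebesgue measure is scaled by `|det A|⁻¹`, so the density against it must carry a
  -- factor `|det A|`; this is the square root of `det (A Aᵀ)`.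
  have hd : (fun z : ι → ℝ => ENNReal.ofReal ((√((2 * Real.pi) ^ Fintype.card ι))⁻¹ *
      Real.exp (-(z ⬝ᵥ z) / 2))) =
      fun z => (ENNReal.ofReal |A.det| • normalDensity (A * Aᵀ) M) (M + A *ᵥ z) := by
    ext z
    rw [Pi.smul_apply, smul_eq_mul, normalDensity, ← ENNReal.ofReal_mul (abs_nonneg _),
      add_sub_cancel_left, precisionForm_mul_transpose hA, det_mul, det_transpose,
      Real.sqrt_mul (by positivity), Real.sqrt_mul_self_eq_abs, mul_inv]
    congr 1
    have : |A.det| ≠ 0 := abs_ne_zero.2 h0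
    field_simp
  rw [pi_gaussianReal_eq_withDensity, hd, map_withDensity_of_measurePreserving hmap
    (hmeas.const_smul _), withDensity_smul_measure, withDensity_smul _ hmeas, smul_smul,
    ← ENNReal.ofReal_mul (abs_nonneg _), ← abs_mul, inv_mul_cancel₀ h0]
  simp

end Gaussian

/-! ### Measurability of matrix operations and densities -/

section MatrixMeasurability

open Matrix

instance instBorelSpaceMatrixReal {p q : Type*} [Countable p] [Countable q] :
    BorelSpace (Matrix p q ℝ) :=
  inferInstanceAs (BorelSpace (p → q → ℝ))

variable {ι : Type*} [Fintype ι] [DecidableEq ι]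

theorem measurable_matrix_inv : Measurable fun C : Matrix ι ι ℝ => C⁻¹ := by
  have h : (fun C : Matrix ι ι ℝ => C⁻¹) = fun C => (C.det)⁻¹ • C.adjugate := by
    ext1 C
    rw [Matrix.inv_def, Ring.inverse_eq_inv']
  have hdet : Measurable fun C : Matrix ι ι ℝ => C.det := by
    exact (continuous_id.matrix_det).measurable
  have hadj : Measurable fun C : Matrix ι ι ℝ => C.adjugate := by
    exact (continuous_id.matrix_adjugate).measurable
  rw [h]
  refine measurable_pi_iff.2 fun i => measurable_pi_iff.2 fun j => ?_
  exact hdet.inv.mul (measurable_pi_iff.1 (measurable_pi_iff.1 hadj i) j)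

theorem measurable_matrix_det : Measurable fun C : Matrix ι ι ℝ => C.det :=
  (continuous_id.matrix_det).measurable

theorem measurable_precisionForm :
    Measurable fun p : Matrix ι ι ℝ × (ι → ℝ) => precisionForm p.1 p.2 := by
  have h (i j : ι) : Measurable fun C : Matrix ι ι ℝ => C⁻¹ i j :=
    measurable_pi_iff.1 (measurable_pi_iff.1 measurable_matrix_inv i) j
  have h' (i j : ι) : Measurable fun p : Matrix ι ι ℝ × (ι → ℝ) => p.1⁻¹ i j :=
    (h i j).comp measurable_fst
  have hz (i : ι) : Measurable fun p : Matrix ι ι ℝ × (ι → ℝ) => p.2 i :=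
    (measurable_pi_apply i).comp measurable_snd
  exact Finset.measurable_sum _ fun i _ => (hz i).mul
    (Finset.measurable_sum _ fun j _ => (h' i j).mul (hz j))

theorem measurable_normalDensity {α : Type*} [MeasurableSpace α] {C : α → Matrix ι ι ℝ}
    {M y : α → ι → ℝ} (hC : Measurable C) (hM : Measurable M) (hy : Measurable y) :
    Measurable fun a => normalDensity (C a) (M a) (y a) := by
  unfold normalDensity
  have h1 := measurable_matrix_det.comp hC
  have h2 : Measurable fun a => precisionForm (C a) (y a - M a) :=
    measurable_precisionForm.comp (hC.prodMk (hy.sub hM))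
  exact ENNReal.measurable_ofReal.comp
    (((h1.const_mul _).sqrt.inv).mul (Real.measurable_exp.comp (h2.neg.div_const 2)))

theorem measurable_normalDensity_right (C : Matrix ι ι ℝ) (M : ι → ℝ) :
    Measurable (normalDensity C M) :=
  measurable_normalDensity measurable_const measurable_const measurable_id

theorem measurableSet_posDef : MeasurableSet {X : Matrix ι ι ℝ | X.PosDef} := by
  have h1 : IsClosed {X : Matrix ι ι ℝ | X.PosSemidef} := by
    simp only [posSemidef_iff_dotProduct_mulVec, Set.ofPred_and, Set.ofPred_forall]
    refine IsClosed.inter (isClosed_eq (by fun_prop) (by fun_prop)) (isClosed_iInter fun x => ?_)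
    exact isClosed_le (by fun_prop) (by fun_prop)
  have h2 : {X : Matrix ι ι ℝ | X.PosDef} =
      {X : Matrix ι ι ℝ | X.PosSemidef} ∩ {X : Matrix ι ι ℝ | X.det ≠ 0} := by
    ext X
    exact ⟨fun h => ⟨h.posSemidef, h.det_pos.ne'⟩, fun h => h.1.posDef_iff_det_ne_zero.2 h.2⟩
  rw [h2]
  exact h1.measurableSet.inter (measurable_matrix_det (measurableSet_singleton 0).compl)

end MatrixMeasurability

/-! ### Normal conjugacy by completing the square -/

section NormalConjugacy

open Matrix

variable {ι : Type*} [Fintype ι] [DecidableEq ι] {C : Matrix ι ι ℝ}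

theorem precisionForm_add (hC : C.IsSymm) (u v : ι → ℝ) :
    precisionForm C (u + v) = precisionForm C u + 2 * (u ⬝ᵥ (C⁻¹ *ᵥ v)) + precisionForm C v := by
  have h : v ⬝ᵥ (C⁻¹ *ᵥ u) = u ⬝ᵥ (C⁻¹ *ᵥ v) := by
    rw [dotProduct_comm, ← vecMul_transpose, ← dotProduct_mulVec, transpose_nonsing_inv, hC.eq]
  simp only [precisionForm, mulVec_add, add_dotProduct, dotProduct_add, h]
  ring

theorem precisionForm_smul (c : ℝ) (u : ι → ℝ) :
    precisionForm C (c • u) = c ^ 2 * precisionForm C u := by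
  simp only [precisionForm, mulVec_smul, smul_dotProduct, dotProduct_smul, smul_eq_mul]
  ring

theorem precisionForm_inv_smul (hC : IsUnit C.det) {c : ℝ} (hc : c ≠ 0) (u : ι → ℝ) :
    precisionForm (c⁻¹ • C) u = c * precisionForm C u := by
  have : (c⁻¹ • C)⁻¹ = c • C⁻¹ := by
    refine Matrix.inv_eq_right_inv ?_
    rw [smul_mul_smul_comm, inv_mul_cancel₀ hc, one_smul, mul_nonsing_inv _ hC]
  simp [precisionForm, this, smul_mulVec]

/-- Two completions of the square: around `Ȳ` for the data, which separates the residuals, and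
around the weighted mean of `M₀` and `Ȳ` for the remaining two forms in `M`. -/
theorem sum_precisionForm_sub (hC : C.IsSymm) {n : ℕ} (hn : 0 < n) {κ : ℝ} (hκ : 0 < κ)
    (y : Fin n → ι → ℝ) (M₀ M : ι → ℝ) :
    κ * precisionForm C (M - M₀) + ∑ i, precisionForm C (y i - M) =
      (∑ i, precisionForm C (y i - (n : ℝ)⁻¹ • ∑ i, y i) +
        κ * n / (κ + n) * precisionForm C ((n : ℝ)⁻¹ • ∑ i, y i - M₀)) +
      (κ + n) * precisionForm C
        (M - (κ + n)⁻¹ • (κ • M₀ + (n : ℝ) • ((n : ℝ)⁻¹ • ∑ i, y i))) := by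
  have hn' : (n : ℝ) ≠ 0 := by positivity
  have hκn : κ + n ≠ 0 := by positivity
  set Y : ι → ℝ := (n : ℝ)⁻¹ • ∑ i, y i with hY
  have hsum : ∑ i, (y i - Y) = 0 := by
    rw [Finset.sum_sub_distrib, Finset.sum_const, Finset.card_univ, Fintype.card_fin, hY,
      ← Nat.cast_smul_eq_nsmul ℝ, smul_inv_smul₀ hn', sub_self]
  have h1 : ∑ i, precisionForm C (y i - M) =
      ∑ i, precisionForm C (y i - Y) + n * precisionForm C (Y - M) := by
    have (i : Fin n) : y i - M = (y i - Y) + (Y - M) := by abel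
    simp_rw [this, precisionForm_add hC, Finset.sum_add_distrib, ← Finset.mul_sum,
      ← sum_dotProduct, hsum]
    simp
  -- Both this form and the one in `h3` are expanded in `Ȳ - M₀` and `-(Ȳ - M)` with an identical
  -- cross term, so that only scalar identities remain.
  have h2 : precisionForm C (M - M₀) = precisionForm C (Y - M₀) +
      2 * ((Y - M₀) ⬝ᵥ (C⁻¹ *ᵥ ((-1 : ℝ) • (Y - M)))) + precisionForm C (Y - M) := by
    have : M - M₀ = (Y - M₀) + (-1 : ℝ) • (Y - M) := by
      rw [neg_one_smul]; abel
    rw [this, precisionForm_add hC, precisionForm_smul]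
    ring
  have h3 : precisionForm C (M - (κ + n)⁻¹ • (κ • M₀ + (n : ℝ) • Y)) =
      (κ / (κ + n)) ^ 2 * precisionForm C (Y - M₀) +
      2 * (κ / (κ + n) * ((Y - M₀) ⬝ᵥ (C⁻¹ *ᵥ ((-1 : ℝ) • (Y - M))))) +
        precisionForm C (Y - M) := by
    have : M - (κ + n)⁻¹ • (κ • M₀ + (n : ℝ) • Y) =
        (κ / (κ + n)) • (Y - M₀) + (-1 : ℝ) • (Y - M) := by
      ext i
      simp only [Pi.sub_apply, Pi.smul_apply, Pi.add_apply, smul_eq_mul]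
      field_simp
      ring
    rw [this, precisionForm_add hC, precisionForm_smul, precisionForm_smul, smul_dotProduct,
      smul_eq_mul]
    ring
  rw [h1, h2, h3]
  field_simp
  ring

/-- The marginal density of a normal sample `y` whose mean has the conjugate normal prior with
mean `M₀` and covariance matrix `κ⁻¹ C`. -/
def marginalDensity {n : ℕ} (κ : ℝ) (M₀ : ι → ℝ) (C : Matrix ι ι ℝ) (y : Fin n → ι → ℝ) : ℝ≥0∞ :=
  ENNReal.ofReal ((√((κ⁻¹) ^ Fintype.card ι))⁻¹ * √(((κ + n)⁻¹) ^ Fintype.card ι) *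
    (√((2 * Real.pi) ^ Fintype.card ι * C.det))⁻¹ ^ n *
    Real.exp (-(∑ i, precisionForm C (y i - (n : ℝ)⁻¹ • ∑ i, y i) +
        κ * n / (κ + n) * precisionForm C ((n : ℝ)⁻¹ • ∑ i, y i - M₀)) / 2))

theorem normalDensity_mul_prod_normalDensity (hC : C.PosDef) {n : ℕ} (hn : 0 < n) {κ : ℝ}
    (hκ : 0 < κ) (y : Fin n → ι → ℝ) (M₀ M : ι → ℝ) :
    normalDensity (κ⁻¹ • C) M₀ M * ∏ i, normalDensity C M (y i) =
      marginalDensity κ M₀ C y * normalDensity ((κ + n)⁻¹ • C)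
        ((κ + n)⁻¹ • (κ • M₀ + (n : ℝ) • ((n : ℝ)⁻¹ • ∑ i, y i))) M := by
  have hκn : 0 < κ + n := by positivity
  have hs : C.IsSymm := by simpa [Matrix.IsHermitian, Matrix.IsSymm] using hC.isHermitian
  have hu : IsUnit C.det := hC.det_pos.ne'.isUnit
  have hd := hC.det_pos
  have hsq (c : ℝ) (hc : 0 < c) : √((2 * Real.pi) ^ Fintype.card ι * (c⁻¹ • C).det) =
      √(c⁻¹ ^ Fintype.card ι) * √((2 * Real.pi) ^ Fintype.card ι * C.det) := by
    rw [det_smul, mul_left_comm, Real.sqrt_mul (by positivity)]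
  unfold normalDensity marginalDensity
  rw [← ENNReal.ofReal_prod_of_nonneg fun i _ => by positivity,
    ← ENNReal.ofReal_mul (by positivity), ← ENNReal.ofReal_mul (by positivity),
    Finset.prod_mul_distrib, ← Real.exp_sum, hsq _ hκ, hsq _ hκn,
    precisionForm_inv_smul hu hκ.ne', precisionForm_inv_smul hu hκn.ne', Finset.prod_const,
    Finset.card_univ, Fintype.card_fin]
  congr 1
  have hexp := sum_precisionForm_sub hs hn hκ y M₀ M
  set D := √((2 * Real.pi) ^ Fintype.card ι * C.det)
  set r := √((κ + n)⁻¹ ^ Fintype.card ι) with hr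
  have hr0 : r ≠ 0 := by positivity
  rw [mul_inv, mul_inv]
  have h1 : ∀ a b c d e : ℝ, a * b * c * (d * e) = a * b * d * (c * e) := by intros; ring
  rw [h1, ← Real.exp_add]
  -- `marginalDensity` contains the factor `r`, which cancels the `r⁻¹` in the normalising constant
  -- of the posterior density.
  have h2 : ∀ a d f e h : ℝ, a * r * d * e * (r⁻¹ * f * h) = (r * r⁻¹) * (a * f * d * (e * h)) :=
    by intros; ring
  rw [h2, ← Real.exp_add, mul_inv_cancel₀ hr0, one_mul]
  congr 2
  rw [← Finset.sum_div, Finset.sum_neg_distrib]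
  linear_combination (-1 / 2) * hexp

end NormalConjugacy

/-! ### Kronecker products and matricization -/

section OuterProduct

open Matrix

/-- The Kronecker matrix of a list of matrices: the outer product as a matrix. -/
def outerMatrix (S : MatList m) : Matrix (Idx m) (Idx m) ℝ := Matrix.of (outer S)

theorem tucker_eq_mulVec (Z : Arr m) (A : MatList m) : tucker Z A = outerMatrix A *ᵥ Z := rfl

theorem outerMatrix_mul (A B : MatList m) :
    outerMatrix A * outerMatrix B = outerMatrix fun k => A k * B k := by
  ext i j
  simp only [outerMatrix, outer, mul_apply, of_apply, Finset.prod_univ_sum,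
    Fintype.piFinset_univ, Finset.prod_mul_distrib]

theorem outerMatrix_one : outerMatrix (fun _ => 1 : MatList m) = 1 := by
  ext i j
  simp only [outerMatrix, outer, of_apply, one_apply, funext_iff]
  by_cases h : ∀ k, i k = j k
  · simp [h]
  · rw [if_neg h]
    push Not at h
    obtain ⟨k, hk⟩ := h
    exact Finset.prod_eq_zero (Finset.mem_univ k) (if_neg hk)

theorem outerMatrix_transpose (A : MatList m) :
    (outerMatrix A)ᵀ = outerMatrix fun k => (A k)ᵀ := rfl

theorem outerMatrix_inv {A : MatList m} (hA : ∀ k, IsUnit (A k).det) :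
    (outerMatrix A)⁻¹ = outerMatrix fun k => (A k)⁻¹ := by
  refine Matrix.inv_eq_right_inv ?_
  simp_rw [outerMatrix_mul, mul_nonsing_inv _ (hA _), outerMatrix_one]

theorem isUnit_det_outerMatrix {A : MatList m} (hA : ∀ k, IsUnit (A k).det) :
    IsUnit (outerMatrix A).det := by
  refine isUnit_det_of_right_inverse (B := outerMatrix fun k => (A k)⁻¹) ?_
  simp_rw [outerMatrix_mul, mul_nonsing_inv _ (hA _), outerMatrix_one]

theorem outerMatrix_mul_transpose_self (A : MatList m) :
    outerMatrix (fun k => A k * (A k)ᵀ) = outerMatrix A * (outerMatrix A)ᵀ := by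
  rw [outerMatrix_transpose, outerMatrix_mul]

theorem posDef_mul_transpose_self {ι : Type*} [Fintype ι] [DecidableEq ι] {A : Matrix ι ι ℝ}
    (hA : IsUnit A.det) : (A * Aᵀ).PosDef := by
  have h := PosDef.mul_conjTranspose_self A
    (vecMul_injective_of_isUnit ((isUnit_iff_isUnit_det A).2 hA))
  rwa [conjTranspose_eq_transpose_of_trivial] at h

open scoped MatrixOrder in
theorem exists_mul_transpose_self_eq {ι : Type*} [Fintype ι] [DecidableEq ι] {S : Matrix ι ι ℝ}
    (hS : S.PosDef) : ∃ A : Matrix ι ι ℝ, IsUnit A.det ∧ A * Aᵀ = S := by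
  have h0 : CFC.sqrt S * CFC.sqrt S = S := CFC.sqrt_mul_sqrt_self S hS.posSemidef.nonneg
  have h1 : (CFC.sqrt S)ᵀ = CFC.sqrt S := by
    have := (CFC.sqrt_nonneg S).posSemidef.isHermitian
    rwa [IsHermitian, conjTranspose_eq_transpose_of_trivial] at this
  have h2 : CFC.sqrt S * (CFC.sqrt S)ᵀ = S := by rw [h1, h0]
  refine ⟨_, ?_, h2⟩
  have h3 := congrArg Matrix.det h0
  rw [det_mul] at h3
  exact isUnit_of_mul_isUnit_left (h3 ▸ hS.det_pos.ne'.isUnit)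

theorem posDef_outerMatrix {S : MatList m} (hS : ∀ k, (S k).PosDef) : (outerMatrix S).PosDef := by
  choose A hA hAS using fun k => exists_mul_transpose_self_eq (hS k)
  obtain rfl : (fun k => A k * (A k)ᵀ) = S := funext hAS
  rw [outerMatrix_mul_transpose_self]
  exact posDef_mul_transpose_self (isUnit_det_outerMatrix hA)

theorem IsArrayNormal.eq_withDensity {ρ : Measure (Arr m)} {M : Arr m} {C : Idx m → Idx m → ℝ}
    (h : IsArrayNormal ρ M C) : ρ = volume.withDensity (normalDensity (Matrix.of C) M) := by
  obtain ⟨A, hA, rfl, rfl⟩ := h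
  simp_rw [tucker_eq_mulVec]
  rw [stdArrayNormal, map_add_mulVec_pi_gaussianReal (isUnit_det_outerMatrix hA),
    ← outerMatrix_mul_transpose_self]
  rfl

theorem IsArrayNormal.isProbabilityMeasure {ρ : Measure (Arr m)} {M : Arr m}
    {C : Idx m → Idx m → ℝ} (h : IsArrayNormal ρ M C) : IsProbabilityMeasure ρ := by
  obtain ⟨A, hA, rfl, rfl⟩ := h
  have : IsProbabilityMeasure (stdArrayNormal m) := by unfold stdArrayNormal; infer_instance
  refine Measure.isProbabilityMeasure_map (Measurable.aemeasurable ?_)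
  simp_rw [tucker_eq_mulVec]
  fun_prop

theorem isArrayNormal_smul_outer (hK : 0 < K) {S : MatList m} (hS : ∀ k, (S k).PosDef) {c : ℝ}
    (hc : 0 < c) (M : Arr m) :
    IsArrayNormal (volume.withDensity (normalDensity (c • outerMatrix S) M)) M (c • outer S) := by
  -- The scalar `c` is absorbed into the factor of mode zero, which exists because `0 < K`.
  set T : MatList m := fun k => (if k = ⟨0, hK⟩ then c else 1) • S k with hT
  have hTS : c • outer S = outer T := by
    ext i j
    simp only [outer, hT, Pi.smul_apply, Matrix.smul_apply, smul_eq_mul, Finset.prod_mul_distrib,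
      Finset.prod_ite_eq', Finset.mem_univ, if_true]
  have hTpos : ∀ k, (T k).PosDef := fun k => (hS k).smul (by split_ifs <;> positivity)
  choose A hA hAT using fun k => exists_mul_transpose_self_eq (hTpos k)
  have hAT' : outer T = outer fun k => A k * (A k)ᵀ := by simp_rw [hAT]
  refine ⟨A, hA, hTS.trans hAT', ?_⟩
  have := IsArrayNormal.eq_withDensity (ρ := (stdArrayNormal m).map fun Z => M + tucker Z A)
    ⟨A, hA, hTS.trans hAT', rfl⟩
  rw [this]
  rfl

/-- The Kronecker matrix of the matrices of the modes other than `k`. -/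
def outerMatrixExcept (k : Fin K) (S : MatListExcept m k) :
    Matrix (∀ j : {j : Fin K // j ≠ k}, Fin (m j)) (∀ j : {j : Fin K // j ≠ k}, Fin (m j)) ℝ :=
  Matrix.of fun c d => ∏ j, S j (c j) (d j)

/-- Splitting off one index turns the `K`-fold product into an ordinary Kronecker product, to which
the two-factor determinant formula applies. -/
theorem outerMatrix_eq_submatrix (k : Fin K) (S : MatList m) :
    outerMatrix S = (kroneckerMap (· * ·) (S k) (outerMatrixExcept k fun j => S j)).submatrix
      (Equiv.piSplitAt k fun j => Fin (m j)) (Equiv.piSplitAt k fun j => Fin (m j)) := by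
  ext i j
  simp only [outerMatrix, outer, of_apply, submatrix_apply, kroneckerMap_apply,
    outerMatrixExcept, Equiv.piSplitAt_apply]
  exact Fintype.prod_eq_mul_prod_subtype_ne _ k

theorem card_indexExcept (k : Fin K) :
    Fintype.card (∀ j : {j : Fin K // j ≠ k}, Fin (m j)) = ∏ j ∈ Finset.univ.erase k, m j := by
  rw [Fintype.card_pi]
  simp only [Fintype.card_fin]
  rw [← Finset.prod_subtype (Finset.univ.erase k) (by simp) m]

theorem det_outerMatrix (k : Fin K) (S : MatList m) :
    (outerMatrix S).det = (S k).det ^ (∏ j ∈ Finset.univ.erase k, m j) *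
      (outerMatrixExcept k fun j => S j).det ^ m k := by
  rw [outerMatrix_eq_submatrix k, det_submatrix_equiv_self]
  have := det_kronecker (S k) (outerMatrixExcept k fun j => S j)
  rwa [card_indexExcept, Fintype.card_fin] at this

theorem dotProduct_outerMatrix_mulVec (k : Fin K) {S : MatList m} (hS : ∀ j, j ≠ k → S j = 1)
    (z : Arr m) :
    z ⬝ᵥ (outerMatrix S *ᵥ z) = (S k * (unfold k z * (unfold k z)ᵀ)).trace := by
  have hE : outerMatrixExcept k (fun j => S j) = 1 := by
    ext c d
    simp only [outerMatrixExcept, of_apply, one_apply, funext_iff]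
    have h1 (j : {j : Fin K // j ≠ k}) : S j = 1 := hS j j.2
    simp only [h1, one_apply]
    by_cases h : ∀ j, c j = d j
    · simp [h]
    · rw [if_neg h]
      push Not at h
      obtain ⟨j, hj⟩ := h
      exact Finset.prod_eq_zero (Finset.mem_univ j) (if_neg hj)
  set e : Idx m ≃ Fin (m k) × (∀ j : {j : Fin K // j ≠ k}, Fin (m j)) :=
    Equiv.piSplitAt k fun j => Fin (m j) with he
  have hent (p q) : outerMatrix S (e.symm p) (e.symm q) =
      S k p.1 q.1 * if p.2 = q.2 then 1 else 0 := by
    rw [outerMatrix_eq_submatrix k, hE, submatrix_apply, kroneckerMap_apply, ← he,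
      e.apply_symm_apply, e.apply_symm_apply, one_apply]
  simp only [dotProduct, mulVec, trace, diag, mul_apply, transpose_apply]
  rw [← e.symm.sum_comp]
  simp_rw [← e.symm.sum_comp, hent, Fintype.sum_prod_type, Finset.mul_sum]
  simp only [mul_ite, ite_mul, mul_one, mul_zero, zero_mul, Finset.sum_ite_eq, Finset.mem_univ,
    if_true]
  refine Finset.sum_congr rfl fun a _ => ?_
  rw [Finset.sum_comm]
  refine Finset.sum_congr rfl fun b _ => Finset.sum_congr rfl fun c _ => ?_
  simp only [unfold, of_apply, ← he]
  ring

theorem precisionForm_outerMatrix (k : Fin K) {S : MatList m} (hS : ∀ j, (S j).PosDef)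
    (A : MatListExcept m k) (hA : ∀ j : {j : Fin K // j ≠ k}, S j = A j * (A j)ᵀ) (z : Arr m) :
    precisionForm (outerMatrix S) z = ((S k)⁻¹ * (unfold k (tucker z (invExcept k A)) *
      (unfold k (tucker z (invExcept k A)))ᵀ)).trace := by
  -- With `B` the Kronecker matrix of `invExcept k A` and `T` equal to `(S k)⁻¹` in mode `k` and to
  -- the identity elsewhere, `Bᵀ T B` is the full inverse: each other mode contributes `A_j⁻ᵀ A_j⁻¹
  -- = S_j⁻¹`. Only this product enters, so the choice of square root is immaterial.
  set T : MatList m := fun j => if j = k then (S j)⁻¹ else 1 with hT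
  have hTk : (S k)⁻¹ = T k := by simp [hT]
  rw [hTk, ← dotProduct_outerMatrix_mulVec k (fun j hj => by simp [hT, hj]), tucker_eq_mulVec,
    mulVec_mulVec, precisionForm, outerMatrix_inv fun j => (hS j).det_pos.ne'.isUnit,
    ← vecMul_transpose (outerMatrix (invExcept k A)) z, ← dotProduct_mulVec, mulVec_mulVec,
    outerMatrix_transpose, outerMatrix_mul, outerMatrix_mul]
  congr 3
  ext1 j
  by_cases hj : j = k
  · simp [hT, hj, invExcept]
  · simp only [hT, hj, invExcept, if_false, dif_neg, not_false_eq_true, one_mul]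
    rw [hA ⟨j, hj⟩, Matrix.mul_inv_rev, transpose_nonsing_inv]

end OuterProduct

/-! ### The inverse-Wishart law and its scaling -/

section InverseWishart

open Matrix

variable {d : ℕ}

theorem measurable_matrix_trace_mul {α : Type*} [MeasurableSpace α] {ι : Type*} [Fintype ι]
    {U V : α → Matrix ι ι ℝ} (hU : Measurable U) (hV : Measurable V) :
    Measurable fun a => (U a * V a).trace := by
  simp only [trace, diag, mul_apply]
  exact Finset.measurable_sum _ fun i _ => Finset.measurable_sum _ fun j _ =>
    (measurable_pi_iff.1 (measurable_pi_iff.1 hU i) j).mul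
      (measurable_pi_iff.1 (measurable_pi_iff.1 hV j) i)

theorem measurable_symmOfUpper : Measurable (symmOfUpper : _ → Matrix (Fin d) (Fin d) ℝ) :=
  measurable_pi_iff.2 fun _ => measurable_pi_iff.2 fun _ => measurable_pi_apply _

theorem symmOfUpper_injective :
    Function.Injective (symmOfUpper : _ → Matrix (Fin d) (Fin d) ℝ) := by
  intro s t h
  ext p
  have := congrFun (congrFun h p.1.1) p.1.2
  simpa [symmOfUpper, min_eq_left p.2, max_eq_right p.2] using this

theorem symmOfUpper_smul (c : ℝ) (t : {p : Fin d × Fin d // p.1 ≤ p.2} → ℝ) :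
    symmOfUpper (c • t) = c • symmOfUpper t := rfl

/-- Lebesgue measure `∏_{i ≤ j} dx_{ij}` on symmetric matrices. -/
def symmVolume (d : ℕ) : Measure (Matrix (Fin d) (Fin d) ℝ) := volume.map symmOfUpper

/-- A push-forward need not be σ-finite; here it is, since an injective measurable map between
standard Borel spaces is a measurable embedding. -/
instance instSigmaFiniteSymmVolume : SigmaFinite (symmVolume d) :=
  (measurable_symmOfUpper.measurableEmbedding symmOfUpper_injective).sigmaFinite_map

theorem measurable_invWishartKernel {α : Type*} [MeasurableSpace α]
    {V X : α → Matrix (Fin d) (Fin d) ℝ} (hV : Measurable V) (ν : ℝ) (hX : Measurable X) :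
    Measurable fun a => invWishartKernel (V a) ν (X a) := by
  unfold invWishartKernel
  refine Measurable.ite (hX measurableSet_posDef) (ENNReal.measurable_ofReal.comp ?_)
    measurable_const
  have h1 : Measurable fun a => (X a).det := measurable_matrix_det.comp hX
  have h2 := measurable_matrix_trace_mul (measurable_matrix_inv.comp hV)
    (measurable_matrix_inv.comp hX)
  exact (h1.pow_const _).mul (Real.measurable_exp.comp (h2.neg.div_const 2))

theorem measurable_invWishartKernel_right (V : Matrix (Fin d) (Fin d) ℝ) (ν : ℝ) :
    Measurable (invWishartKernel V ν) :=
  measurable_invWishartKernel measurable_const ν measurable_id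

theorem invWishartUnnorm_eq_withDensity (V : Matrix (Fin d) (Fin d) ℝ) (ν : ℝ) :
    invWishartUnnorm V ν = (symmVolume d).withDensity (invWishartKernel V ν) :=
  map_withDensity_of_measurePreserving (measurable_symmOfUpper.measurePreserving volume)
    (measurable_invWishartKernel_right V ν)

theorem invWishartUnnorm_univ (V : Matrix (Fin d) (Fin d) ℝ) (ν : ℝ) :
    invWishartUnnorm V ν Set.univ = ∫⁻ t, invWishartKernel V ν (symmOfUpper t) := by
  rw [invWishartUnnorm, Measure.map_apply measurable_symmOfUpper MeasurableSet.univ]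
  simp

theorem invWishart_eq_withDensity (V : Matrix (Fin d) (Fin d) ℝ) (ν : ℝ) :
    invWishart V ν = (symmVolume d).withDensity fun X =>
      (invWishartUnnorm V ν Set.univ)⁻¹ * invWishartKernel V ν X := by
  rw [invWishart, invWishartUnnorm_eq_withDensity, ← withDensity_smul _
    (measurable_invWishartKernel_right V ν)]
  rfl

instance instIsFiniteMeasureInvWishart (V : Matrix (Fin d) (Fin d) ℝ) (ν : ℝ) :
    IsFiniteMeasure (invWishart V ν) :=
  ⟨by
    rw [invWishart, Measure.smul_apply, smul_eq_mul]
    exact (ENNReal.inv_mul_le_one _).trans_lt ENNReal.one_lt_top⟩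

theorem ae_posDef_invWishart (V : Matrix (Fin d) (Fin d) ℝ) (ν : ℝ) :
    ∀ᵐ X ∂(invWishart V ν), X.PosDef := by
  rw [invWishart_eq_withDensity, ae_withDensity_iff
    ((measurable_invWishartKernel_right V ν).const_mul _)]
  refine Filter.Eventually.of_forall fun X hX => ?_
  by_contra h
  exact hX (by rw [invWishartKernel, if_neg h, mul_zero])

theorem card_upper (d : ℕ) :
    Fintype.card {p : Fin d × Fin d // p.1 ≤ p.2} * 2 = d * (d + 1) := by
  have h : Fintype.card {p : Fin d × Fin d // p.1 ≤ p.2} = ∑ j : Fin d, ((j : ℕ) + 1) := by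
    rw [Fintype.card_subtype, Finset.card_filter, Fintype.sum_prod_type_right]
    refine Finset.sum_congr rfl fun j _ => ?_
    rw [← Finset.card_filter, ← Fin.card_Iic]
    congr 1
    ext i
    simp
  rw [h, Fin.sum_univ_eq_sum_range (fun j => j + 1) d, ← add_zero (∑ i ∈ Finset.range d, (i + 1)),
    ← Finset.sum_range_succ' (fun j => j) d, Finset.sum_range_id_mul_two]
  simp [mul_comm]

/-- The trace term is unchanged because `(g S)(g X)⁻¹ = S X⁻¹`; only the determinant scales, by `g ^
d`. -/
theorem invWishartKernel_smul {g : ℝ} (hg : 0 < g) {S : Matrix (Fin d) (Fin d) ℝ}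
    (hS : S.PosDef) (ν : ℝ) (X : Matrix (Fin d) (Fin d) ℝ) :
    invWishartKernel (g • S)⁻¹ ν (g • X) =
      ENNReal.ofReal (g ^ (d * (-(ν + d + 1) / 2))) * invWishartKernel S⁻¹ ν X := by
  have hX : (g • X).PosDef ↔ X.PosDef :=
    ⟨fun h => by simpa [smul_smul, inv_mul_cancel₀ hg.ne'] using h.smul (inv_pos.2 hg),
      fun h => h.smul hg⟩
  unfold invWishartKernel
  rw [hX]
  split_ifs with h
  · have hS' : IsUnit (g • S).det := (hS.smul hg).det_pos.ne'.isUnit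
    have hinv : (g • X)⁻¹ = g⁻¹ • X⁻¹ := by
      refine Matrix.inv_eq_right_inv ?_
      rw [smul_mul_smul_comm, mul_inv_cancel₀ hg.ne', one_smul,
        mul_nonsing_inv _ h.det_pos.ne'.isUnit]
    rw [← ENNReal.ofReal_mul (by positivity), nonsing_inv_nonsing_inv _ hS',
      nonsing_inv_nonsing_inv _ hS.det_pos.ne'.isUnit, hinv, smul_mul_smul_comm,
      mul_inv_cancel₀ hg.ne', one_smul, det_smul, Fintype.card_fin,
      Real.mul_rpow (by positivity) h.det_pos.le, ← Real.rpow_natCast, ← Real.rpow_mul hg.le,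
      mul_assoc]
  · rw [mul_zero]

theorem invWishartUnnorm_smul_univ {g : ℝ} (hg : 0 < g) {S : Matrix (Fin d) (Fin d) ℝ}
    (hS : S.PosDef) (ν : ℝ) :
    invWishartUnnorm (g • S)⁻¹ ν Set.univ =
      ENNReal.ofReal (g ^ (-(ν * d / 2))) * invWishartUnnorm S⁻¹ ν Set.univ := by
  have hm (V : Matrix (Fin d) (Fin d) ℝ) : Measurable fun t => invWishartKernel V ν
      (symmOfUpper t) := measurable_invWishartKernel measurable_const ν measurable_symmOfUpper
  set D := Fintype.card {p : Fin d × Fin d // p.1 ≤ p.2} with hD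
  have h1 : ENNReal.ofReal (g ^ D)⁻¹ * invWishartUnnorm (g • S)⁻¹ ν Set.univ =
      ENNReal.ofReal (g ^ (d * (-(ν + d + 1) / 2))) * invWishartUnnorm S⁻¹ ν Set.univ := by
    simp_rw [invWishartUnnorm_univ]
    have hmap := Measure.map_addHaar_smul
      (volume : Measure ({p : Fin d × Fin d // p.1 ≤ p.2} → ℝ)) hg.ne'
    rw [Module.finrank_fintype_fun_eq_card, ← hD, abs_of_pos (by positivity)] at hmap
    rw [← smul_eq_mul, ← lintegral_smul_measure, ← hmap,
      lintegral_map (hm _) (measurable_const_smul g), ← lintegral_const_mul _ (hm _)]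
    simp_rw [symmOfUpper_smul, invWishartKernel_smul hg hS]
  have h2 : ENNReal.ofReal (g ^ D) * ENNReal.ofReal (g ^ D)⁻¹ = 1 := by
    rw [← ENNReal.ofReal_mul (by positivity), mul_inv_cancel₀ (by positivity), ENNReal.ofReal_one]
  rw [← one_mul (invWishartUnnorm (g • S)⁻¹ ν Set.univ), ← h2, mul_assoc, h1, ← mul_assoc,
    ← ENNReal.ofReal_mul (by positivity), ← Real.rpow_natCast, ← Real.rpow_add hg]
  congr 3
  -- The Jacobian exponent `d (d + 1) / 2` cancels part of `-d (ν + d + 1) / 2` and leaves `-ν d /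
  -- 2`.
  have h3 : (D : ℝ) * 2 = d * (d + 1) := by exact_mod_cast card_upper d
  linear_combination h3 / 2

theorem trace_inv_mul_nonneg {X S : Matrix (Fin d) (Fin d) ℝ} (hX : X.PosDef) (hS : S.PosDef) :
    0 ≤ (X⁻¹ * S).trace := by
  obtain ⟨A, -, rfl⟩ := exists_mul_transpose_self_eq hS
  rw [← Matrix.mul_assoc, trace_mul_comm, ← Matrix.mul_assoc]
  have := (hX.inv.posSemidef.conjTranspose_mul_mul_same A).trace_nonneg
  rwa [conjTranspose_eq_transpose_of_trivial] at this

end InverseWishart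

/-! ### The conditional law of the prior scale -/

section RandomScale

open Matrix

/-- Density in `(g, σ)` of the conditional law of the covariance matrices `σ` given the scale `g`,
with respect to Lebesgue measure on symmetric matrices. -/
def scaleDensity (S : MatList m) (ν : Fin K → ℝ) (g : ℝ) (σ : MatList m) : ℝ≥0∞ :=
  ∏ k, (invWishartUnnorm (g • S k)⁻¹ (ν k) Set.univ)⁻¹ *
    invWishartKernel (g • S k)⁻¹ (ν k) (σ k)

theorem measurable_scaleDensity {α : Type*} [MeasurableSpace α] (S : MatList m) (ν : Fin K → ℝ)
    {g : α → ℝ} {σ : α → MatList m} (hg : Measurable g) (hσ : Measurable σ) :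
    Measurable fun a => scaleDensity S ν (g a) (σ a) := by
  have hV (k : Fin K) : Measurable fun g : ℝ => (g • S k)⁻¹ := by
    refine measurable_matrix_inv.comp (measurable_pi_iff.2 fun i => measurable_pi_iff.2 fun j => ?_)
    exact measurable_id.mul_const _
  have hZ (k : Fin K) : Measurable fun g : ℝ => invWishartUnnorm (g • S k)⁻¹ (ν k) Set.univ := by
    simp_rw [invWishartUnnorm_univ]
    exact Measurable.lintegral_prod_right' (measurable_invWishartKernel
      ((hV k).comp measurable_fst) (ν k) (measurable_symmOfUpper.comp measurable_snd))
  exact Finset.measurable_prod _ fun k _ => ((hZ k).comp hg).inv.mul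
    (measurable_invWishartKernel ((hV k).comp hg) (ν k) ((measurable_pi_apply k).comp hσ))

theorem pi_invWishart_eq_withDensity (V : MatList m) (ν : Fin K → ℝ) :
    Measure.pi (fun k => invWishart (V k) (ν k)) =
      (Measure.pi fun k => symmVolume (m k)).withDensity fun σ =>
        ∏ k, (invWishartUnnorm (V k) (ν k) Set.univ)⁻¹ * invWishartKernel (V k) (ν k) (σ k) := by
  have (k : Fin K) : SigmaFinite ((symmVolume (m k)).withDensity fun X =>
      (invWishartUnnorm (V k) (ν k) Set.univ)⁻¹ * invWishartKernel (V k) (ν k) X) := by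
    rw [← invWishart_eq_withDensity]
    infer_instance
  simp_rw [invWishart_eq_withDensity]
  exact pi_withDensity _ fun k => (measurable_invWishartKernel_right _ _).const_mul _

theorem scaleDensity_of_not_posDef (S : MatList m) (ν : Fin K → ℝ) (g : ℝ) {σ : MatList m}
    {k : Fin K} (hσ : ¬ (σ k).PosDef) : scaleDensity S ν g σ = 0 :=
  Finset.prod_eq_zero (Finset.mem_univ k) (by rw [invWishartKernel, if_neg hσ, mul_zero])

theorem scaleDensity_eq {S : MatList m} (hS : ∀ k, (S k).PosDef) (ν : Fin K → ℝ) {σ : MatList m}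
    (hσ : ∀ k, (σ k).PosDef) :
    ∃ c : ℝ≥0∞, ∀ g : ℝ, 0 < g → scaleDensity S ν g σ =
      c * ENNReal.ofReal (g ^ (∑ k, ν k * m k / 2) *
        Real.exp (-(g * ∑ k, ((σ k)⁻¹ * S k).trace / 2))) := by
  -- The constant collects what does not involve `g`: the normalisers at `g = 1` and the
  -- determinants of the `σ k`.
  refine ⟨∏ k, (invWishartUnnorm (S k)⁻¹ (ν k) Set.univ)⁻¹ *
    ENNReal.ofReal ((σ k).det ^ (-(ν k + m k + 1) / 2)), fun g hg => ?_⟩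
  have h (k : Fin K) : (invWishartUnnorm (g • S k)⁻¹ (ν k) Set.univ)⁻¹ *
      invWishartKernel (g • S k)⁻¹ (ν k) (σ k) =
      ((invWishartUnnorm (S k)⁻¹ (ν k) Set.univ)⁻¹ *
        ENNReal.ofReal ((σ k).det ^ (-(ν k + m k + 1) / 2))) *
      ENNReal.ofReal (g ^ (ν k * m k / 2) *
        Real.exp (-(g * (((σ k)⁻¹ * S k).trace / 2)))) := by
    have hpos : 0 < g ^ (-(ν k * m k / 2)) := Real.rpow_pos_of_pos hg _
    rw [invWishartUnnorm_smul_univ hg (hS k), ENNReal.mul_inv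
      (.inl (ENNReal.ofReal_pos.2 hpos).ne') (.inl ENNReal.ofReal_ne_top),
      ← ENNReal.ofReal_inv_of_pos hpos, ← Real.rpow_neg hg.le, neg_neg, invWishartKernel,
      if_pos (hσ k), nonsing_inv_nonsing_inv _ ((hS k).smul hg).det_pos.ne'.isUnit,
      smul_mul, trace_smul, trace_mul_comm, smul_eq_mul,
      ENNReal.ofReal_mul (Real.rpow_nonneg (hσ k).det_pos.le _),
      ENNReal.ofReal_mul (Real.rpow_nonneg hg.le _),
      show -(g * ((σ k)⁻¹ * S k).trace) / 2 = -(g * (((σ k)⁻¹ * S k).trace / 2)) by ring]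
    ring
  unfold scaleDensity
  rw [Finset.prod_congr rfl fun k _ => h k, Finset.prod_mul_distrib,
    ← ENNReal.ofReal_prod_of_nonneg fun k _ => by positivity, Finset.prod_mul_distrib,
    Finset.prod_mul_distrib, ← Real.exp_sum, ← Real.rpow_sum_of_pos hg, Finset.sum_neg_distrib, Finset.mul_sum]

theorem measurable_gammaPDF (a b : ℝ) : Measurable (gammaPDF a b) :=
  (measurable_gammaPDFReal a b).ennreal_ofReal

theorem withDensity_gammaPDF_mul {a b s t : ℝ} (ha : 0 < a) (hb : 0 < b) (hs : 0 ≤ s) (ht : 0 ≤ t)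
    {c : ℝ≥0∞} {f : ℝ → ℝ≥0∞}
    (hf : ∀ g, 0 < g → f g = c * ENNReal.ofReal (g ^ s * Real.exp (-(g * t)))) :
    ∃ e : ℝ≥0∞, (volume.withDensity fun g => gammaPDF a b g * f g) =
      e • gammaMeasure (a + s) (b + t) := by
  have ha' : 0 < a + s := by positivity
  have hb' : 0 < b + t := by positivity
  set u := b ^ a / Real.Gamma a with hu
  set v := (b + t) ^ (a + s) / Real.Gamma (a + s) with hv
  have hΓ := Real.Gamma_pos_of_pos ha
  have hΓ' := Real.Gamma_pos_of_pos ha'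
  have hv0 : 0 < v := by positivity
  -- `u` and `v` are the normalising constants of the old and the new gamma density.
  refine ⟨c * ENNReal.ofReal (u / v), ?_⟩
  rw [gammaMeasure, ← withDensity_smul _ (measurable_gammaPDF _ _)]
  refine withDensity_congr_ae ?_
  filter_upwards [Measure.ae_ne volume (0 : ℝ)] with g hg
  rw [Pi.smul_apply, smul_eq_mul]
  rcases lt_or_gt_of_ne hg with hg | hg
  · rw [gammaPDF_of_neg hg, gammaPDF_of_neg hg, zero_mul, mul_zero]
  · rw [gammaPDF_of_nonneg hg.le, gammaPDF_of_nonneg hg.le, hf g hg, mul_left_comm,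
      ← ENNReal.ofReal_mul (by positivity), mul_assoc c, ← ENNReal.ofReal_mul (by positivity)]
    congr 2
    rw [show a + s - 1 = (a - 1) + s by ring, Real.rpow_add hg,
      show -((b + t) * g) = -(b * g) + -(g * t) by ring, Real.exp_add, ← hu, ← hv]
    field_simp

theorem RandomScalePrior.condDistrib_scale {Ω : Type*} [MeasurableSpace Ω] {P : Measure Ω}
    [IsProbabilityMeasure P] {a b : ℝ} (ha : 0 < a) (hb : 0 < b) {S : MatList m}
    (hS : ∀ k, (S k).PosDef) {ν : Fin K → ℝ} (hν : ∀ k, 0 ≤ ν k) {γ : Ω → ℝ} {Sig : Ω → MatList m}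
    (h : RandomScalePrior P a b S ν γ Sig) :
    ∀ᵐ σ ∂(P.map Sig), condDistrib γ Sig P σ =
      gammaMeasure (a + ∑ k, ν k * m k / 2) (b + ∑ k, ((σ k)⁻¹ * S k).trace / 2) := by
  set μ : Measure (MatList m) := Measure.pi fun k => symmVolume (m k) with hμ
  have hj : P.map (fun ω => (γ ω, Sig ω)) = (volume.prod μ).withDensity fun p =>
      gammaPDF a b p.1 * scaleDensity S ν p.1 p.2 := by
    refine map_prodMk_eq_withDensity (μ := volume) (ν := μ) (f := gammaPDF a b) h.measurable_Sig
      (measurable_gammaPDF a b) (measurable_scaleDensity S ν measurable_fst measurable_snd) h.law_γ ?_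
    filter_upwards [h.cond_Sig] with g hg
    rw [hg, pi_invWishart_eq_withDensity]
    rfl
  set F : MatList m × ℝ → ℝ≥0∞ := fun p => gammaPDF a b p.2 * scaleDensity S ν p.2 p.1 with hF
  have hFm : Measurable F :=
    ((measurable_gammaPDF a b).comp measurable_snd).mul 
      (measurable_scaleDensity S ν measurable_snd measurable_fst)
  have hj' : P.map (fun ω => (Sig ω, γ ω)) = (μ.prod volume).withDensity F := by
    rw [map_prodMk_swap_eq_withDensity h.measurable_γ h.measurable_Sig
      (((measurable_gammaPDF a b).comp measurable_fst).mul
        (measurable_scaleDensity S ν measurable_fst measurable_snd)) hj]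
    rfl
  -- The marginal density of `Sig` vanishes wherever some `σ k` is not positive definite.
  have hpos : ∀ᵐ σ ∂(P.map Sig), ∀ k, (σ k).PosDef := by
    rw [map_fst_eq_withDensity h.measurable_Sig h.measurable_γ hFm hj',
      ae_withDensity_iff hFm.lintegral_prod_right']
    refine Filter.Eventually.of_forall fun σ hσ k => ?_
    by_contra hk
    exact hσ (by simp [hF, scaleDensity_of_not_posDef S ν _ hk])
  filter_upwards [hpos, condDistrib_ae_eq_of_isProbabilityMeasure h.measurable_Sig h.measurable_γ
    hFm hj'] with σ hσ hcond
  have hs : 0 ≤ ∑ k, ν k * m k / 2 :=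
    Finset.sum_nonneg fun k _ => by have := hν k; positivity
  have ht : 0 ≤ ∑ k, ((σ k)⁻¹ * S k).trace / 2 :=
    Finset.sum_nonneg fun k _ => div_nonneg (trace_inv_mul_nonneg (hσ k) (hS k)) two_pos.le
  obtain ⟨c, hc⟩ := scaleDensity_eq hS ν hσ
  obtain ⟨e, he⟩ := withDensity_gammaPDF_mul ha hb hs ht hc
  exact hcond _ e (isProbabilityMeasure_gammaMeasure (by positivity) (by positivity)) he

end RandomScale

/-! ### Joint law of data, covariances and mean; the conditional law of the mean -/

section Semiconjugate

open Matrix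

theorem measurable_outerMatrix : Measurable (outerMatrix : MatList m → _) :=
  measurable_pi_iff.2 fun i => measurable_pi_iff.2 fun j => by
    change Measurable fun σ : MatList m => ∏ k, σ k (i k) (j k)
    exact Finset.measurable_prod _ fun k _ =>
      measurable_pi_iff.1 (measurable_pi_iff.1 (measurable_pi_apply k) (i k)) (j k)

theorem measurable_smul_outerMatrix (c : ℝ) :
    Measurable fun σ : MatList m => c • outerMatrix σ :=
  measurable_pi_iff.2 fun i => measurable_pi_iff.2 fun j =>
    (measurable_pi_iff.1 (measurable_pi_iff.1 measurable_outerMatrix i) j).const_mul c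

theorem measurable_marginalDensity {α ι : Type*} [MeasurableSpace α] [Fintype ι] [DecidableEq ι]
    {n : ℕ} (κ : ℝ) (M₀ : ι → ℝ) {C : α → Matrix ι ι ℝ} {y : α → Fin n → ι → ℝ}
    (hC : Measurable C) (hy : Measurable y) :
    Measurable fun a => marginalDensity κ M₀ (C a) (y a) := by
  unfold marginalDensity
  have hyi (i : Fin n) : Measurable fun a => y a i := (measurable_pi_apply i).comp hy
  have hmean : Measurable fun a => (n : ℝ)⁻¹ • ∑ i, y a i :=
    (measurable_const_smul _).comp (Finset.measurable_sum _ fun i _ => hyi i)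
  have h1 : Measurable fun a => (C a).det := measurable_matrix_det.comp hC
  have h2 (i : Fin n) : Measurable fun a => precisionForm (C a) (y a i - (n : ℝ)⁻¹ • ∑ i, y a i) :=
    measurable_precisionForm.comp (hC.prodMk ((hyi i).sub hmean))
  have h3 : Measurable fun a => precisionForm (C a) ((n : ℝ)⁻¹ • ∑ i, y a i - M₀) :=
    measurable_precisionForm.comp (hC.prodMk (hmean.sub_const M₀))
  exact ENNReal.measurable_ofReal.comp ((((h1.const_mul _).sqrt.inv.pow_const n).const_mul _).mul
    (Real.measurable_exp.comp
      (((Finset.measurable_sum _ fun i _ => h2 i).add (h3.const_mul _)).neg.div_const 2)))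

theorem measurePreserving_reverse {α β γ : Type*} [MeasurableSpace α] [MeasurableSpace β]
    [MeasurableSpace γ] (μ : Measure α) (ν : Measure β) (τ : Measure γ) [SigmaFinite μ]
    [SigmaFinite ν] [SigmaFinite τ] :
    MeasurePreserving (fun p : (α × β) × γ => ((p.2, p.1.2), p.1.1)) ((μ.prod ν).prod τ)
      ((τ.prod ν).prod μ) :=
  ((measurePreserving_prodAssoc τ ν μ).symm.comp
    ((MeasurePreserving.id τ).prod Measure.measurePreserving_swap)).comp
      Measure.measurePreserving_swap

variable {Ω : Type*} [MeasurableSpace Ω] {P : Measure Ω} [IsProbabilityMeasure P] {n : ℕ}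
  {M₀ : Arr m} {κ₀ : ℝ} {S₀ : MatList m} {ν₀ : Fin K → ℝ} {Sig : Ω → MatList m} {M : Ω → Arr m}
  {Y : Ω → Fin n → Arr m}

theorem SemiconjugateModel.ae_posDef (h : SemiconjugateModel P M₀ κ₀ S₀ ν₀ Sig M Y) :
    ∀ᵐ σ ∂(P.map Sig), ∀ k, (σ k).PosDef := by
  refine ae_all_iff.2 fun k => ?_
  have h1 : (P.map Sig).map (fun σ => σ k) = invWishart (S₀ k)⁻¹ (ν₀ k) := by
    rw [Measure.map_map (measurable_pi_apply k) h.measurable_Sig, ← h.law_Sig k]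
    rfl
  have h2 := ae_posDef_invWishart (S₀ k)⁻¹ (ν₀ k)
  rw [← h1] at h2
  exact ae_of_ae_map (measurable_pi_apply k).aemeasurable h2

theorem SemiconjugateModel.map_Y_Sig_M (h : SemiconjugateModel P M₀ κ₀ S₀ ν₀ Sig M Y) :
    P.map (fun ω => ((Y ω, Sig ω), M ω)) =
      (((volume : Measure (Fin n → Arr m)).prod (P.map Sig)).prod volume).withDensity fun p =>
        normalDensity (κ₀⁻¹ • outerMatrix p.1.2) M₀ p.2 *
          ∏ i, normalDensity (outerMatrix p.1.2) p.2 (p.1.1 i) := by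
  have hL : IsProbabilityMeasure (P.map Sig) :=
    Measure.isProbabilityMeasure_map h.measurable_Sig.aemeasurable
  have hd1 : Measurable fun p : MatList m × Arr m =>
      normalDensity (κ₀⁻¹ • outerMatrix p.1) M₀ p.2 :=
    measurable_normalDensity ((measurable_smul_outerMatrix _).comp measurable_fst)
      measurable_const measurable_snd
  have hd2 : Measurable fun p : (Arr m × MatList m) × (Fin n → Arr m) =>
      ∏ i, normalDensity (outerMatrix p.1.2) p.1.1 (p.2 i) :=
    Finset.measurable_prod _ fun i _ => measurable_normalDensity
      (measurable_outerMatrix.comp (measurable_snd.comp measurable_fst))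
      (measurable_fst.comp measurable_fst) ((measurable_pi_apply i).comp measurable_snd)
  -- The law of `Sig` serves as its own reference measure, with density one, so the prior on the
  -- covariances stays unexpanded.
  have h1 := map_prodMk_eq_withDensity (P := P) (X := Sig) (μ := P.map Sig) (ν := volume)
    (f := fun _ => 1) h.measurable_M measurable_const hd1 withDensity_one.symm (by
      filter_upwards [h.cond_M] with σ hσ
      exact hσ.eq_withDensity)
  simp only [one_mul] at h1
  have h2 := map_prodMk_swap_eq_withDensity h.measurable_Sig h.measurable_M hd1 h1
  have h3 := map_prodMk_eq_withDensity (ν := volume) h.measurable_Y (hd1.comp measurable_swap)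
    hd2 h2 (by
      filter_upwards [h.cond_Y] with p hp
      obtain ⟨ρ, hρ, hY⟩ := hp
      have := hρ.isProbabilityMeasure
      rw [hY, volume_pi]
      have hρ' := hρ.eq_withDensity
      have : SigmaFinite ((volume : Measure (Arr m)).withDensity
          (normalDensity (Matrix.of (outer p.2)) p.1)) := by
        rw [← hρ']
        infer_instance
      rw [hρ']
      exact pi_withDensity _ fun _ => measurable_normalDensity_right _ _)
  have hF : Measurable fun p : ((Fin n → Arr m) × MatList m) × Arr m =>
      normalDensity (κ₀⁻¹ • outerMatrix p.1.2) M₀ p.2 *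
          ∏ i, normalDensity (outerMatrix p.1.2) p.2 (p.1.1 i) := by
    refine Measurable.mul (measurable_normalDensity ((measurable_smul_outerMatrix _).comp
      (measurable_snd.comp measurable_fst)) measurable_const measurable_snd)
      (Finset.measurable_prod _ fun i _ => measurable_normalDensity
        (measurable_outerMatrix.comp (measurable_snd.comp measurable_fst)) measurable_snd
        ((measurable_pi_apply i).comp (measurable_fst.comp measurable_fst)))
  -- The coordinates are reversed so that `M` comes last, ready to be conditioned on `(Y, Sig)`.
  have he := measurePreserving_reverse (volume : Measure (Arr m)) (P.map Sig)
    (volume : Measure (Fin n → Arr m))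
  rw [← map_withDensity_of_measurePreserving he hF]
  refine Eq.trans ?_ (congrArg (Measure.map _) h3)
  rw [Measure.map_map he.measurable
    ((h.measurable_M.prodMk h.measurable_Sig).prodMk h.measurable_Y)]
  rfl

/-- The joint density of the data and the mean array factors into the marginal density of the data
and the posterior density of the mean array. -/
theorem SemiconjugateModel.map_Y_Sig_M_eq (h : SemiconjugateModel P M₀ κ₀ S₀ ν₀ Sig M Y)
    (hn : 0 < n) (hκ : 0 < κ₀) :
    P.map (fun ω => ((Y ω, Sig ω), M ω)) =
      (((volume : Measure (Fin n → Arr m)).prod (P.map Sig)).prod volume).withDensity fun p =>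
        marginalDensity κ₀ M₀ (outerMatrix p.1.2) p.1.1 *
          normalDensity ((κ₀ + n)⁻¹ • outerMatrix p.1.2)
            ((κ₀ + n)⁻¹ • (κ₀ • M₀ + (n : ℝ) • sampleMean p.1.1)) p.2 := by
  have hL : IsProbabilityMeasure (P.map Sig) :=
    Measure.isProbabilityMeasure_map h.measurable_Sig.aemeasurable
  rw [h.map_Y_Sig_M]
  refine withDensity_congr_ae ?_
  have hpos : ∀ᵐ p ∂(((volume : Measure (Fin n → Arr m)).prod (P.map Sig)).prod
      (volume : Measure (Arr m))), ∀ k, (p.1.2 k).PosDef :=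
    Measure.quasiMeasurePreserving_fst.ae (Measure.quasiMeasurePreserving_snd.ae h.ae_posDef)
  filter_upwards [hpos] with p hp
  exact normalDensity_mul_prod_normalDensity (posDef_outerMatrix hp) hn hκ p.1.1 M₀ p.2

theorem measurable_posteriorDensity (κ : ℝ) (M₀ : Arr m) :
    Measurable fun p : ((Fin n → Arr m) × MatList m) × Arr m =>
      marginalDensity κ M₀ (outerMatrix p.1.2) p.1.1 *
        normalDensity ((κ + n)⁻¹ • outerMatrix p.1.2)
          ((κ + n)⁻¹ • (κ • M₀ + (n : ℝ) • sampleMean p.1.1)) p.2 := by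
  have hs : Measurable fun y : Fin n → Arr m =>
      (κ + n)⁻¹ • (κ • M₀ + (n : ℝ) • sampleMean y) := by
    unfold sampleMean
    fun_prop
  exact (measurable_marginalDensity κ M₀ (measurable_outerMatrix.comp
    (measurable_snd.comp measurable_fst)) (measurable_fst.comp measurable_fst)).mul
    (measurable_normalDensity ((measurable_smul_outerMatrix _).comp
      (measurable_snd.comp measurable_fst)) (hs.comp (measurable_fst.comp measurable_fst))
      measurable_snd)

theorem SemiconjugateModel.ae_posDef_Y_Sig (h : SemiconjugateModel P M₀ κ₀ S₀ ν₀ Sig M Y) :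
    ∀ᵐ p ∂(P.map (fun ω => (Y ω, Sig ω))), ∀ k, (p.2 k).PosDef := by
  have h1 : (P.map (fun ω => (Y ω, Sig ω))).map Prod.snd = P.map Sig := by
    rw [Measure.map_map measurable_snd (h.measurable_Y.prodMk h.measurable_Sig)]
    rfl
  have h2 := h.ae_posDef
  rw [← h1] at h2
  exact ae_of_ae_map measurable_snd.aemeasurable h2

theorem SemiconjugateModel.condDistrib_mean (h : SemiconjugateModel P M₀ κ₀ S₀ ν₀ Sig M Y)
    (hK : 0 < K) (hn : 0 < n) (hκ : 0 < κ₀) :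
    ∀ᵐ p ∂(P.map (fun ω => (Y ω, Sig ω))),
      IsArrayNormal (condDistrib M (fun ω => (Y ω, Sig ω)) P p)
        ((κ₀ + n)⁻¹ • (κ₀ • M₀ + (n : ℝ) • sampleMean p.1)) ((κ₀ + n)⁻¹ • outer p.2) := by
  have hL : IsProbabilityMeasure (P.map Sig) :=
    Measure.isProbabilityMeasure_map h.measurable_Sig.aemeasurable
  filter_upwards [h.ae_posDef_Y_Sig, condDistrib_ae_eq_of_isProbabilityMeasure
    (h.measurable_Y.prodMk h.measurable_Sig) h.measurable_M (measurable_posteriorDensity κ₀ M₀)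
    (h.map_Y_Sig_M_eq hn hκ)] with p hp hc
  have hnorm := isArrayNormal_smul_outer hK hp (c := (κ₀ + n)⁻¹) (by positivity)
    ((κ₀ + n)⁻¹ • (κ₀ • M₀ + (n : ℝ) • sampleMean p.1))
  rw [hc _ (marginalDensity κ₀ M₀ (outerMatrix p.2) p.1) hnorm.isProbabilityMeasure ?_]
  · exact hnorm
  · exact withDensity_smul _ (measurable_normalDensity_right _ _)

/-- The posterior density of `M` integrates to one, so integrating `M` out leaves the other factor.
-/
theorem SemiconjugateModel.map_Y_Sig (h : SemiconjugateModel P M₀ κ₀ S₀ ν₀ Sig M Y)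
    (hK : 0 < K) (hn : 0 < n) (hκ : 0 < κ₀) :
    P.map (fun ω => (Y ω, Sig ω)) =
      ((volume : Measure (Fin n → Arr m)).prod (P.map Sig)).withDensity fun p =>
        marginalDensity κ₀ M₀ (outerMatrix p.2) p.1 := by
  have hL : IsProbabilityMeasure (P.map Sig) :=
    Measure.isProbabilityMeasure_map h.measurable_Sig.aemeasurable
  rw [map_fst_eq_withDensity (h.measurable_Y.prodMk h.measurable_Sig) h.measurable_M
    (measurable_posteriorDensity κ₀ M₀) (h.map_Y_Sig_M_eq hn hκ)]
  refine withDensity_congr_ae ?_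
  have hpos : ∀ᵐ p ∂((volume : Measure (Fin n → Arr m)).prod (P.map Sig)),
      ∀ k, (p.2 k).PosDef := Measure.quasiMeasurePreserving_snd.ae h.ae_posDef
  filter_upwards [hpos] with p hp
  have hnorm := isArrayNormal_smul_outer hK hp (c := (κ₀ + n)⁻¹) (by positivity)
    ((κ₀ + n)⁻¹ • (κ₀ • M₀ + (n : ℝ) • sampleMean p.1))
  have h1 := hnorm.isProbabilityMeasure.measure_univ
  rw [withDensity_apply _ MeasurableSet.univ, Measure.restrict_univ] at h1
  rw [lintegral_const_mul _ (measurable_normalDensity_right _ _), h1, mul_one]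

end Semiconjugate

/-! ### The conditional law of one covariance matrix -/

section CovarianceConditional

open Matrix

theorem measurePreserving_piSplitAt_symm {ι : Type*} [Fintype ι] [DecidableEq ι] {β : ι → Type*}
    [∀ i, MeasurableSpace (β i)] (μ : ∀ i, Measure (β i)) [∀ i, SigmaFinite (μ i)] (k : ι) :
    MeasurePreserving (Equiv.piSplitAt k β).symm
      ((μ k).prod (Measure.pi fun j : {j // j ≠ k} => μ j)) (Measure.pi μ) := by
  have hm : Measurable (Equiv.piSplitAt k β).symm := by
    refine measurable_pi_iff.2 fun j => ?_
    by_cases hj : j = k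
    · subst hj
      simpa [Equiv.piSplitAt] using measurable_fst
    · simpa [Equiv.piSplitAt, hj, Function.comp_def] using
        (measurable_pi_apply (⟨j, hj⟩ : {j // j ≠ k})).comp measurable_snd
  refine ⟨hm, (Measure.pi_eq fun s hs => ?_).symm⟩
  have hpre : (Equiv.piSplitAt k β).symm ⁻¹' (Set.univ.pi s) =
      s k ×ˢ Set.univ.pi fun j : {j // j ≠ k} => s j := by
    ext p
    simp only [Set.mem_preimage, Set.mem_univ_pi, Set.mem_prod]
    refine ⟨fun h => ⟨by simpa [Equiv.piSplitAt] using h k, fun j => by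
      simpa [Equiv.piSplitAt, j.2] using h j⟩, fun h j => ?_⟩
    by_cases hj : j = k
    · subst hj
      simpa [Equiv.piSplitAt] using h.1
    · simpa [Equiv.piSplitAt, hj] using h.2 ⟨j, hj⟩
  rw [Measure.map_apply hm (MeasurableSet.univ_pi hs), hpre, Measure.prod_prod, Measure.pi_pi,
    Fintype.prod_eq_mul_prod_subtype_ne _ k]

theorem measurePreserving_piSplitAt_swap {ι : Type*} [Fintype ι] [DecidableEq ι] {β : ι → Type*}
    [∀ i, MeasurableSpace (β i)] (μ : ∀ i, Measure (β i)) [∀ i, SigmaFinite (μ i)] (k : ι) :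
    MeasurePreserving (fun x : ∀ i, β i => ((fun j : {j // j ≠ k} => x j), x k)) (Measure.pi μ)
      ((Measure.pi fun j : {j // j ≠ k} => μ j).prod (μ k)) := by
  have h := measurePreserving_piSplitAt_symm μ k
  have hm : Measurable fun x : ∀ i, β i => ((fun j : {j // j ≠ k} => x j), x k) := by fun_prop
  refine ⟨hm, ?_⟩
  rw [← h.map_eq, Measure.map_map hm h.measurable]
  exact (congrArg (fun f => Measure.map f ((μ k).prod (Measure.pi fun j : {j // j ≠ k} => μ j)))
    (funext fun p => congrArg Prod.swap ((Equiv.piSplitAt k β).apply_symm_apply p))).trans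
      Measure.prod_swap

theorem unfold_smul (k : Fin K) (c : ℝ) (Z : Arr m) : unfold k (c • Z) = c • unfold k Z := rfl

/-- Stacking along an extra mode concatenates columns, so the Gram matrix of the stack is the sum of
the individual Gram matrices. -/
theorem trace_inv_mul_residualSS {n : ℕ} (k : Fin K) (A : MatListExcept m k) (y : Fin n → Arr m)
    (X : Matrix (Fin (m k)) (Fin (m k)) ℝ) :
    (X * residualSS k A y).trace = ∑ i, (X * (unfold k (tucker (y i - sampleMean y)
      (invExcept k A)) * (unfold k (tucker (y i - sampleMean y) (invExcept k A)))ᵀ)).trace := by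
  rw [← trace_sum, ← Matrix.mul_sum]
  congr 2
  ext a b
  rw [Matrix.sum_apply]
  simp only [residualSS, mul_apply, transpose_apply, unfoldStack, of_apply,
    Fintype.sum_prod_type_right]

theorem trace_inv_mul_meanDeviation {n : ℕ} (k : Fin K) (A : MatListExcept m k)
    (y : Fin n → Arr m) (M₀ : Arr m) {κ : ℝ} (hκ : 0 < κ) (X : Matrix (Fin (m k)) (Fin (m k)) ℝ) :
    (X * (unfold k (meanDeviation k A y M₀ κ) * (unfold k (meanDeviation k A y M₀ κ))ᵀ)).trace =
      κ * n / (κ + n) * (X * (unfold k (tucker (sampleMean y - M₀) (invExcept k A)) *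
        (unfold k (tucker (sampleMean y - M₀) (invExcept k A)))ᵀ)).trace := by
  rw [meanDeviation, unfold_smul, transpose_smul, Matrix.smul_mul, Matrix.mul_smul, Matrix.mul_smul,
    Matrix.mul_smul, smul_smul, Real.mul_self_sqrt (by positivity), trace_smul, smul_eq_mul]

theorem sqrt_pow_inv_pow {x : ℝ} (hx : 0 < x) (p n : ℕ) :
    (√(x ^ p))⁻¹ ^ n = x ^ (-((n * p : ℕ) : ℝ) / 2) := by
  rw [Real.sqrt_eq_rpow, ← Real.rpow_natCast x p, ← Real.rpow_mul hx.le, ← Real.rpow_neg hx.le,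
    ← Real.rpow_natCast _ n, ← Real.rpow_mul hx.le]
  congr 1
  push_cast
  ring

/-- The posterior scale matrix of mode `k` given the data and the other covariance matrices. -/
def posteriorScale {n : ℕ} (k : Fin K) (S : Matrix (Fin (m k)) (Fin (m k)) ℝ)
    (A : MatListExcept m k) (y : Fin n → Arr m) (M₀ : Arr m) (κ : ℝ) :
    Matrix (Fin (m k)) (Fin (m k)) ℝ :=
  S + residualSS k A y +
    unfold k (meanDeviation k A y M₀ κ) * (unfold k (meanDeviation k A y M₀ κ)).transpose

theorem posDef_posteriorScale {n : ℕ} (k : Fin K) {S : Matrix (Fin (m k)) (Fin (m k)) ℝ}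
    (hS : S.PosDef) (A : MatListExcept m k) (y : Fin n → Arr m) (M₀ : Arr m) (κ : ℝ) :
    (posteriorScale k S A y M₀ κ).PosDef := by
  refine (hS.add_posSemidef ?_).add_posSemidef ?_
  · have := posSemidef_self_mul_conjTranspose
      (unfoldStack k fun i => tucker (y i - sampleMean y) (invExcept k A))
    rwa [conjTranspose_eq_transpose_of_trivial] at this
  · have := posSemidef_self_mul_conjTranspose (unfold k (meanDeviation k A y M₀ κ))
    rwa [conjTranspose_eq_transpose_of_trivial] at this

/-- Conjugacy in mode `k`: the likelihood contributes `|X| ^ (-n_k / 2)` and the trace of `X⁻¹`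
against the residual and mean-deviation Gram matrices. -/
theorem invWishartKernel_mul_marginalDensity {n : ℕ} (k : Fin K)
    {S : Matrix (Fin (m k)) (Fin (m k)) ℝ} (hS : S.PosDef) (ν : ℝ) {s : MatListExcept m k}
    (hs : ∀ j, (s j).PosDef) (A : MatListExcept m k) (hA : ∀ j, s j = A j * (A j)ᵀ)
    (y : Fin n → Arr m) (M₀ : Arr m) {κ : ℝ} (hκ : 0 < κ) :
    ∃ c : ℝ≥0∞, ∀ X, invWishartKernel S⁻¹ ν X * marginalDensity κ M₀
        (outerMatrix ((Equiv.piSplitAt k fun j => Matrix (Fin (m j)) (Fin (m j)) ℝ).symm (X, s))) y =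
      c * invWishartKernel (posteriorScale k S A y M₀ κ)⁻¹ (ν + modeSampleSize m n k) X := by
  -- The factors of the marginal density free of `X`; of the determinant, only the power belonging
  -- to the other modes remains.
  refine ⟨ENNReal.ofReal ((√((κ⁻¹) ^ Fintype.card (Idx m)))⁻¹ *
    √(((κ + n)⁻¹) ^ Fintype.card (Idx m)) *
    (√((2 * Real.pi) ^ Fintype.card (Idx m) * (outerMatrixExcept k s).det ^ m k))⁻¹ ^ n),
    fun X => ?_⟩
  by_cases hX : X.PosDef
  swap
  · rw [invWishartKernel, if_neg hX, invWishartKernel, if_neg hX, zero_mul, mul_zero]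
  set σ : MatList m := (Equiv.piSplitAt k fun j => Matrix (Fin (m j)) (Fin (m j)) ℝ).symm (X, s)
    with hσ
  have hσk : σ k = X := by simp [hσ, Equiv.piSplitAt]
  have hσj (j : {j : Fin K // j ≠ k}) : σ j = s j := by simp [hσ, Equiv.piSplitAt, j.2]
  have hσpos (j : Fin K) : (σ j).PosDef := by
    by_cases hj : j = k
    · subst hj
      rwa [hσk]
    · have := hs ⟨j, hj⟩
      rwa [← hσj ⟨j, hj⟩] at this
  have hq (z : Arr m) := precisionForm_outerMatrix k hσpos A (fun j => (hσj j).trans (hA j)) z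
  have hdet : (2 * Real.pi) ^ Fintype.card (Idx m) * (outerMatrix σ).det =
      X.det ^ (∏ j ∈ Finset.univ.erase k, m j) *
        ((2 * Real.pi) ^ Fintype.card (Idx m) * (outerMatrixExcept k s).det ^ m k) := by
    rw [det_outerMatrix k, hσk, funext hσj]
    ring
  have hx := hX.det_pos
  have hT := posDef_posteriorScale k hS A y M₀ κ
  have htr : (posteriorScale k S A y M₀ κ * X⁻¹).trace = (S * X⁻¹).trace +
      (∑ i, precisionForm (outerMatrix σ) (y i - (n : ℝ)⁻¹ • ∑ i, y i) +
        κ * n / (κ + n) * precisionForm (outerMatrix σ) ((n : ℝ)⁻¹ • ∑ i, y i - M₀)) := by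
    simp_rw [hq, hσk]
    rw [posteriorScale, Matrix.add_mul, Matrix.add_mul, trace_add, trace_add,
      trace_mul_comm (residualSS k A y), trace_inv_mul_residualSS,
      trace_mul_comm (unfold k (meanDeviation k A y M₀ κ) * _) X⁻¹,
      trace_inv_mul_meanDeviation k A y M₀ hκ, add_assoc]
    rfl
  unfold invWishartKernel marginalDensity
  rw [if_pos hX, if_pos hX, nonsing_inv_nonsing_inv _ hT.det_pos.ne'.isUnit,
    nonsing_inv_nonsing_inv _ hS.det_pos.ne'.isUnit, htr, hdet, Real.sqrt_mul (by positivity),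
    mul_inv, mul_pow, sqrt_pow_inv_pow hx, ← ENNReal.ofReal_mul (by positivity),
    ← ENNReal.ofReal_mul (by positivity),
    show -(ν + (modeSampleSize m n k : ℝ) + m k + 1) / 2 =
      -(ν + m k + 1) / 2 + -((n * ∏ j ∈ Finset.univ.erase k, m j : ℕ) : ℝ) / 2 by
        rw [modeSampleSize]; ring,
    Real.rpow_add hx (-(ν + m k + 1) / 2), neg_add (S * X⁻¹).trace,
    add_div (-(S * X⁻¹).trace), Real.exp_add]
  congr 1
  ring

variable {Ω : Type*} [MeasurableSpace Ω] {P : Measure Ω} [IsProbabilityMeasure P] {n : ℕ}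
  {M₀ : Arr m} {κ₀ : ℝ} {S₀ : MatList m} {ν₀ : Fin K → ℝ} {Sig : Ω → MatList m} {M : Ω → Arr m}
  {Y : Ω → Fin n → Arr m}

theorem SemiconjugateModel.map_Sig (h : SemiconjugateModel P M₀ κ₀ S₀ ν₀ Sig M Y) :
    P.map Sig = Measure.pi fun k => invWishart (S₀ k)⁻¹ (ν₀ k) := by
  have := (iIndepFun_iff_map_fun_eq_pi_map fun k =>
    ((measurable_pi_apply k).comp h.measurable_Sig).aemeasurable).1 h.indep_Sig
  simp_rw [← h.law_Sig]
  exact this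

/-- By independence the prior is a product. Only its factor in mode `k` is written as a density; the
other factors remain in the reference measure. -/
theorem SemiconjugateModel.map_Y_Sig_split (h : SemiconjugateModel P M₀ κ₀ S₀ ν₀ Sig M Y)
    (hK : 0 < K) (hn : 0 < n) (hκ : 0 < κ₀) (k : Fin K) :
    P.map (fun ω => ((Y ω, fun j : {j : Fin K // j ≠ k} => Sig ω j), Sig ω k)) =
      (((volume : Measure (Fin n → Arr m)).prod (Measure.pi fun j : {j : Fin K // j ≠ k} =>
        invWishart (S₀ j)⁻¹ (ν₀ j))).prod (symmVolume (m k))).withDensity fun p =>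
          (invWishartUnnorm (S₀ k)⁻¹ (ν₀ k) Set.univ)⁻¹ *
            (invWishartKernel (S₀ k)⁻¹ (ν₀ k) p.2 * marginalDensity κ₀ M₀ (outerMatrix
              ((Equiv.piSplitAt k fun j => Matrix (Fin (m j)) (Fin (m j)) ℝ).symm
                (p.2, p.1.2))) p.1.1) := by
  set μ : ∀ j, Measure (Matrix (Fin (m j)) (Fin (m j)) ℝ) := fun j =>
    invWishart (S₀ j)⁻¹ (ν₀ j) with hμ
  set e := Equiv.piSplitAt k fun j => Matrix (Fin (m j)) (Fin (m j)) ℝ with he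
  have hsplit := measurePreserving_piSplitAt_symm μ k
  have hH : Measurable fun p : ((Fin n → Arr m) × MatListExcept m k) ×
      Matrix (Fin (m k)) (Fin (m k)) ℝ =>
      marginalDensity κ₀ M₀ (outerMatrix (e.symm (p.2, p.1.2))) p.1.1 :=
    measurable_marginalDensity κ₀ M₀ (measurable_outerMatrix.comp (hsplit.measurable.comp
      (measurable_snd.prodMk (measurable_snd.comp measurable_fst))))
      (measurable_fst.comp measurable_fst)
  have hmp : MeasurePreserving (fun p : (Fin n → Arr m) × MatList m =>
      ((p.1, fun j : {j : Fin K // j ≠ k} => p.2 j), p.2 k))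
      ((volume : Measure (Fin n → Arr m)).prod (Measure.pi μ))
      (((volume : Measure (Fin n → Arr m)).prod
        (Measure.pi fun j : {j : Fin K // j ≠ k} => μ j)).prod (μ k)) :=
    (measurePreserving_prodAssoc _ _ _).symm.comp
      ((MeasurePreserving.id _).prod (measurePreserving_piSplitAt_swap μ k))
  have h1 : P.map (fun ω => ((Y ω, fun j : {j : Fin K // j ≠ k} => Sig ω j), Sig ω k)) =
      (((volume : Measure (Fin n → Arr m)).prod (Measure.pi fun j : {j : Fin K // j ≠ k} =>
        μ j)).prod (μ k)).withDensity fun p =>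
          marginalDensity κ₀ M₀ (outerMatrix (e.symm (p.2, p.1.2))) p.1.1 := by
    rw [← map_withDensity_of_measurePreserving hmp hH]
    have h2 (σ : MatList m) : e.symm (σ k, fun j : {j : Fin K // j ≠ k} => σ j) = σ :=
      e.symm_apply_apply σ
    simp only [h2]
    rw [hμ, ← h.map_Sig, ← h.map_Y_Sig hK hn hκ, Measure.map_map hmp.measurable
      (h.measurable_Y.prodMk h.measurable_Sig)]
    rfl
  have hk := (measurable_invWishartKernel_right (S₀ k)⁻¹ (ν₀ k)).const_mul
    (invWishartUnnorm (S₀ k)⁻¹ (ν₀ k) Set.univ)⁻¹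
  have hk' : Measurable fun p : ((Fin n → Arr m) × MatListExcept m k) ×
      Matrix (Fin (m k)) (Fin (m k)) ℝ => (invWishartUnnorm (S₀ k)⁻¹ (ν₀ k) Set.univ)⁻¹ *
        invWishartKernel (S₀ k)⁻¹ (ν₀ k) p.2 := hk.comp measurable_snd
  have hμk : μ k = (symmVolume (m k)).withDensity fun X =>
      (invWishartUnnorm (S₀ k)⁻¹ (ν₀ k) Set.univ)⁻¹ * invWishartKernel (S₀ k)⁻¹ (ν₀ k) X :=
    invWishart_eq_withDensity _ _
  rw [h1, hμk, prod_withDensity_right hk, ← withDensity_mul _ hk' hH]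
  simp only [Pi.mul_def, mul_assoc]
  rfl

/-- The exceptional null set comes from positive definiteness and from Bayes' rule alone, so it does
not depend on the square roots `A`. -/
theorem SemiconjugateModel.condDistrib_covariance
    (h : SemiconjugateModel P M₀ κ₀ S₀ ν₀ Sig M Y) (hS₀ : ∀ k, (S₀ k).PosDef)
    (hK : 0 < K) (hn : 0 < n) (hκ : 0 < κ₀) (k : Fin K) :
    ∀ᵐ p ∂(P.map (fun ω => (Y ω, fun j : {j : Fin K // j ≠ k} => Sig ω j))),
      ∀ A : MatListExcept m k, (∀ j, p.2 j = A j * (A j)ᵀ) →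
        condDistrib (fun ω => Sig ω k)
            (fun ω => (Y ω, fun j : {j : Fin K // j ≠ k} => Sig ω j)) P p =
          invWishart (posteriorScale k (S₀ k) A p.1 M₀ κ₀)⁻¹
            (ν₀ k + modeSampleSize m n k) := by
  have hrest : Measurable fun σ : MatList m => fun j : {j : Fin K // j ≠ k} => σ j := by fun_prop
  have hYS : Measurable fun ω => (Y ω, fun j : {j : Fin K // j ≠ k} => Sig ω j) :=
    h.measurable_Y.prodMk (hrest.comp h.measurable_Sig)
  have hpos : ∀ᵐ p ∂(P.map (fun ω => (Y ω, fun j : {j : Fin K // j ≠ k} => Sig ω j))),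
      ∀ j, (p.2 j).PosDef := by
    refine ae_all_iff.2 fun j => ?_
    have hj : Measurable fun p : (Fin n → Arr m) × MatListExcept m k => p.2 j :=
      (measurable_pi_apply j).comp measurable_snd
    have hset : MeasurableSet {p : (Fin n → Arr m) × MatListExcept m k | (p.2 j).PosDef} :=
      hj measurableSet_posDef
    rw [ae_map_iff hYS.aemeasurable hset]
    filter_upwards [ae_of_ae_map h.measurable_Sig.aemeasurable h.ae_posDef] with ω hω using hω j
  have hH : Measurable fun p : ((Fin n → Arr m) × MatListExcept m k) ×
      Matrix (Fin (m k)) (Fin (m k)) ℝ =>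
      (invWishartUnnorm (S₀ k)⁻¹ (ν₀ k) Set.univ)⁻¹ *
        (invWishartKernel (S₀ k)⁻¹ (ν₀ k) p.2 * marginalDensity κ₀ M₀ (outerMatrix
          ((Equiv.piSplitAt k fun j => Matrix (Fin (m j)) (Fin (m j)) ℝ).symm
            (p.2, p.1.2))) p.1.1) :=
    (((measurable_invWishartKernel_right _ _).comp measurable_snd).mul
      (measurable_marginalDensity κ₀ M₀ (measurable_outerMatrix.comp
        ((measurePreserving_piSplitAt_symm (fun j => symmVolume (m j)) k).measurable.comp
          (measurable_snd.prodMk (measurable_snd.comp measurable_fst))))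
        (measurable_fst.comp measurable_fst))).const_mul _
  filter_upwards [hpos, condDistrib_ae_eq_normalize hYS
    ((measurable_pi_apply k).comp h.measurable_Sig) hH (h.map_Y_Sig_split hK hn hκ k)]
    with p hp hc A hA
  obtain ⟨c, hcX⟩ := invWishartKernel_mul_marginalDensity k (hS₀ k) (ν₀ k) hp A hA p.1 M₀ hκ
  refine hc (invWishartUnnorm _ _) ((invWishartUnnorm (S₀ k)⁻¹ (ν₀ k) Set.univ)⁻¹ * c) ?_
  rw [invWishartUnnorm_eq_withDensity (posteriorScale k (S₀ k) A p.1 M₀ κ₀)⁻¹, ← withDensity_smul _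
    (measurable_invWishartKernel_right _ _)]
  congr 1
  ext1 X
  rw [hcX X, Pi.smul_apply, smul_eq_mul, mul_assoc]

end CovarianceConditional

end ArrayNormal

end

theorem mainTheorem5 {K : ℕ} (hK : 0 < K) (m : Fin K → ℕ) (hm : ∀ k, 0 < m k)
    (ν₀ : Fin K → ℝ) (hν₀ : ∀ k, (m k : ℝ) - 1 < ν₀ k)
    {Ω : Type*} [MeasurableSpace Ω] (P : Measure Ω) [IsProbabilityMeasure P] :
    (∀ (n : ℕ) (_ : 0 < n) (M₀ : ArrayNormal.Arr m) (κ₀ : ℝ) (_ : 0 < κ₀)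
        (S₀ : ArrayNormal.MatList m) (_ : ∀ k, (S₀ k).PosDef)
        (Sig : Ω → ArrayNormal.MatList m) (M : Ω → ArrayNormal.Arr m)
        (Y : Ω → Fin n → ArrayNormal.Arr m),
        ArrayNormal.SemiconjugateModel P M₀ κ₀ S₀ ν₀ Sig M Y →
      -- the full conditional distribution of the mean array
      (∀ᵐ p ∂(P.map (fun ω => (Y ω, Sig ω))),
        ArrayNormal.IsArrayNormal
          (condDistrib M (fun ω => (Y ω, Sig ω)) P p)
          ((κ₀ + n)⁻¹ • (κ₀ • M₀ + (n : ℝ) • ArrayNormal.sampleMean p.1))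
          ((κ₀ + n)⁻¹ • ArrayNormal.outer p.2)) ∧
      -- the conditional distribution of each covariance matrix given the data and the other ones,
      -- for every choice of square roots of the other ones
      (∀ k : Fin K,
        ∀ᵐ p ∂(P.map (fun ω => (Y ω, fun j : {j : Fin K // j ≠ k} => Sig ω j))),
          ∀ A : ArrayNormal.MatListExcept m k, (∀ j, p.2 j = A j * (A j).transpose) →
            condDistrib (fun ω => Sig ω k)
                (fun ω => (Y ω, fun j : {j : Fin K // j ≠ k} => Sig ω j)) P p =
              ArrayNormal.invWishart
                (S₀ k + ArrayNormal.residualSS k A p.1 +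
                  ArrayNormal.unfold k (ArrayNormal.meanDeviation k A p.1 M₀ κ₀) *
                    (ArrayNormal.unfold k
                      (ArrayNormal.meanDeviation k A p.1 M₀ κ₀)).transpose)⁻¹
                (ν₀ k + ArrayNormal.modeSampleSize m n k))) ∧
    -- the conditional distribution of a gamma distributed prior scale
    (∀ (a b : ℝ) (_ : 0 < a) (_ : 0 < b)
        (Sig₀ : ArrayNormal.MatList m) (_ : ∀ k, (Sig₀ k).PosDef)
        (γ : Ω → ℝ) (Sig : Ω → ArrayNormal.MatList m),
        ArrayNormal.RandomScalePrior P a b Sig₀ ν₀ γ Sig →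
      ∀ᵐ σ ∂(P.map Sig),
        condDistrib γ Sig P σ =
          gammaMeasure (a + ∑ k, ν₀ k * m k / 2) (b + ∑ k, ((σ k)⁻¹ * Sig₀ k).trace / 2)) := by
  refine ⟨fun n hn M₀ κ₀ hκ S₀ hS₀ Sig M Y h =>
    ⟨h.condDistrib_mean hK hn hκ, h.condDistrib_covariance hS₀ hK hn hκ⟩,
    fun a b ha hb Sig₀ hSig₀ γ Sig h => h.condDistrib_scale ha hb hSig₀ fun k => ?_⟩
  -- As `m k ≥ 1`, the bound on `ν₀ k` makes it nonnegative, which keeps the posterior gamma shape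
  -- positive.
  have h1 : (1 : ℝ) ≤ m k := by exact_mod_cast hm k
  linarith [hν₀ k]
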